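/- A \emph{rectilinear Steiner tree} for a finite set $V\subset\mathbb R^2$ is a finite tree drawn in the plane with axis-parallel straight edges such that every point of $V$ is the position of some vertex; the other vertices are Steiner points, and distinct vertices may have the same position. Its length is the sum of the $\ell_1$-lengths of its edges, and $\mathsf{OPT}(V)$ denotes the length of a rectilinear Steiner minimum tree (the infimum of these lengths). \emph{Shifted quadtree.} Let $L=2^k$ with $k\ge 0$, let $V\subset\mathbb Z^2\cap[0,L]^2$ be finite, and let $a,b\in\{0,1,\dots,L-1\}$. The quadtree of the translated set $V+(a,b)\subset[0,2L)^2$ has the root cell $[0,2L]^2$ at level $0$. A level-$i$ cell is a square of side length $2L/2^i$. It is bisected horizontally and vertically into four level-$(i+1)$ cells if it contains at least two points of $V+(a,b)$, and is a leaf otherwise; here a point counts as contained in the cell $[x_0,x_1]\times[y_0,y_1]$ if it lies in $[x_0,x_1)\times[y_0,y_1)$. \emph{Portals.} Let $m,r\ge 1$ be integers. For a side $S$ of a cell, let $S_0\supseteq S$ be the side containing $S$ of a cell of lowest level. The portals on $S$ are those points of $S$ that are an endpoint of $S_0$ or one of the $m$ points dividing $S_0$ into $m+1$ equal parts. \emph{Light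 trees.} A rectilinear Steiner tree for $V+(a,b)$ is \emph{$(m,r)$-light} if each of its edges can be assigned to a leaf cell whose closed square contains it (so an edge on a grid line is put on one side of that line) such that, for each side $S$ of each quadtree cell $Q$, every vertex at which the tree crosses $S$ is located at a portal on $S$, and at most $r$ of these vertices lie on $S$ strictly between the two corners of $Q$ on $S$. Here the tree crosses $S$ at a vertex located on $S$ if one edge at that vertex is assigned to a leaf cell inside $Q$ and another one to a leaf cell on the other side of the line through $S$. \textbf{Theorem (Structure Theorem).} There is an absolute constant $C>0$ such that for all $L=2^k$, all $V$ as above and all integers $m,r\ge 1$: if $a,b$ are chosen independently and uniformly at random from the integers in $[0,L)$, then with probability at least $1/2$ there is an $(m,r)$-light rectilinear Steiner tree for $V+(a,b)$ of length at most $$\Big(1+\frac4r+C\cdot\frac{4\log L}{m}\Big)\,\mathsf{OPT}(V).$$ -/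

import Mathlib

namespace RSMT

/-- A rectilinear Steiner tree for the point set `V`: a finite tree drawn in the plane with
axis-parallel straight edges, one of whose vertices is placed at each point of `V`.
The remaining vertices are Steiner points. Distinct vertices may be placed at the same point, so
that two strands of the tree can run along the two sides of one line. -/
structure SteinerTree (V : Finset (ℝ × ℝ)) where
  /-- number of vertices -/
  n : ℕ
  G : SimpleGraph (Fin n)
  isTree : G.IsTree
  pos : Fin n → ℝ × ℝ
  spans : ∀ p ∈ V, ∃ v, pos v = p
  axisParallel : ∀ u v, G.Adj u v → (pos u).1 = (pos v).1 ∨ (pos u).2 = (pos v).2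

/-- The `ℓ₁` distance in the plane. -/
def l1dist (p q : ℝ × ℝ) : ℝ := |p.1 - q.1| + |p.2 - q.2|

theorem l1dist_comm (p q : ℝ × ℝ) : l1dist p q = l1dist q p := by
  unfold l1dist
  rw [abs_sub_comm p.1, abs_sub_comm p.2]

/-- The length of a drawn edge. -/
def SteinerTree.edgeLength {V : Finset (ℝ × ℝ)} (T : SteinerTree V) : Sym2 (Fin T.n) → ℝ :=
  Sym2.lift ⟨fun u v => l1dist (T.pos u) (T.pos v), fun _ _ => l1dist_comm _ _⟩

open Classical in
/-- The total edge length of a tree. -/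
noncomputable def SteinerTree.length {V : Finset (ℝ × ℝ)} (T : SteinerTree V) : ℝ :=
  ∑ e ∈ T.G.edgeFinset, T.edgeLength e

/-- The length of a rectilinear Steiner minimum tree for `V`. -/
noncomputable def opt (V : Finset (ℝ × ℝ)) : ℝ :=
  sInf (Set.range fun T : SteinerTree V => T.length)

/-- The dyadic cell of level `level` in column `col` and row `row`. -/
structure Cell where
  level : ℕ
  col : ℕ
  row : ℕ

/-- Names of the four sides of a cell. -/
inductive Dir where
  | left
  | right
  | bottom
  | top

namespace Cell

/-- Side length of a cell when the root cell has side length `D`. -/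
noncomputable def size (D : ℝ) (Q : Cell) : ℝ := D / 2 ^ Q.level

noncomputable def xmin (D : ℝ) (Q : Cell) : ℝ := Q.col * Q.size D
noncomputable def xmax (D : ℝ) (Q : Cell) : ℝ := (Q.col + 1) * Q.size D
noncomputable def ymin (D : ℝ) (Q : Cell) : ℝ := Q.row * Q.size D
noncomputable def ymax (D : ℝ) (Q : Cell) : ℝ := (Q.row + 1) * Q.size D

/-- The closed square occupied by a cell. -/
def square (D : ℝ) (Q : Cell) : Set (ℝ × ℝ) :=
  Set.Icc (Q.xmin D) (Q.xmax D) ×ˢ Set.Icc (Q.ymin D) (Q.ymax D)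

/-- The half-open square of a cell, which decides in which cell a point on a grid line counts. -/
def halfOpenSquare (D : ℝ) (Q : Cell) : Set (ℝ × ℝ) :=
  Set.Ico (Q.xmin D) (Q.xmax D) ×ˢ Set.Ico (Q.ymin D) (Q.ymax D)

/-- A side of a cell, with its two corners. -/
def side (D : ℝ) (Q : Cell) : Dir → Set (ℝ × ℝ)
  | .left => {Q.xmin D} ×ˢ Set.Icc (Q.ymin D) (Q.ymax D)
  | .right => {Q.xmax D} ×ˢ Set.Icc (Q.ymin D) (Q.ymax D)
  | .bottom => Set.Icc (Q.xmin D) (Q.xmax D) ×ˢ {Q.ymin D}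
  | .top => Set.Icc (Q.xmin D) (Q.xmax D) ×ˢ {Q.ymax D}

/-- A side of a cell without its two corners. -/
def openSide (D : ℝ) (Q : Cell) : Dir → Set (ℝ × ℝ)
  | .left => {Q.xmin D} ×ˢ Set.Ioo (Q.ymin D) (Q.ymax D)
  | .right => {Q.xmax D} ×ˢ Set.Ioo (Q.ymin D) (Q.ymax D)
  | .bottom => Set.Ioo (Q.xmin D) (Q.xmax D) ×ˢ {Q.ymin D}
  | .top => Set.Ioo (Q.xmin D) (Q.xmax D) ×ˢ {Q.ymax D}

/-- `Q.Beyond D d R`: the cell `R` lies on the far side of the line that carries side `d` of `Q`. -/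
def Beyond (D : ℝ) (Q : Cell) : Dir → Cell → Prop
  | .left, R => R.xmax D ≤ Q.xmin D
  | .right, R => Q.xmax D ≤ R.xmin D
  | .bottom, R => R.ymax D ≤ Q.ymin D
  | .top, R => Q.ymax D ≤ R.ymin D

/-- The `m + 2` equally spaced points on a side: the two corners (`t = 0` and `t = m + 1`) and
`m` points between them. -/
noncomputable def sidePoint (D : ℝ) (m : ℕ) (Q : Cell) : Dir → ℕ → ℝ × ℝ
  | .left, t => (Q.xmin D, Q.ymin D + t / (m + 1) * Q.size D)
  | .right, t => (Q.xmax D, Q.ymin D + t / (m + 1) * Q.size D)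
  | .bottom, t => (Q.xmin D + t / (m + 1) * Q.size D, Q.ymin D)
  | .top, t => (Q.xmin D + t / (m + 1) * Q.size D, Q.ymax D)

open Classical in
/-- The number of points of `V` in a cell. -/
noncomputable def count (D : ℝ) (V : Finset (ℝ × ℝ)) (Q : Cell) : ℕ :=
  (V.filter fun p => p ∈ Q.halfOpenSquare D).card

/-- The child of a cell, given by the column and row (0 or 1) of the quadrant. -/
def child (Q : Cell) (i j : Fin 2) : Cell :=
  ⟨Q.level + 1, 2 * Q.col + i, 2 * Q.row + j⟩

end Cell

/-- The cells of the quadtree of `V` with root cell `[0, D]²`; a cell is split into its four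
children exactly if it contains at least two points of `V`. -/
inductive InQuadtree (D : ℝ) (V : Finset (ℝ × ℝ)) : Cell → Prop
  | root : InQuadtree D V ⟨0, 0, 0⟩
  | child (Q : Cell) (i j : Fin 2) :
      InQuadtree D V Q → 2 ≤ Q.count D V → InQuadtree D V (Q.child i j)

/-- The leaves of the quadtree. -/
def IsLeaf (D : ℝ) (V : Finset (ℝ × ℝ)) (Q : Cell) : Prop :=
  InQuadtree D V Q ∧ Q.count D V ≤ 1

/-- `p` is a portal on side `d` of the cell `Q`. The portals on a side are spaced according to a
cell of lowest level among those with a side that contains it. -/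
def IsPortal (D : ℝ) (V : Finset (ℝ × ℝ)) (m : ℕ) (Q : Cell) (d : Dir) (p : ℝ × ℝ) : Prop :=
  p ∈ Q.side D d ∧
  ∃ Q₀ d₀, InQuadtree D V Q₀ ∧ Q.side D d ⊆ Q₀.side D d₀ ∧
    (∀ Q₁ d₁, InQuadtree D V Q₁ → Q.side D d ⊆ Q₁.side D d₁ → Q₀.level ≤ Q₁.level) ∧
    ∃ t : ℕ, t ≤ m + 1 ∧ p = Q₀.sidePoint D m d₀ t

/-- An assignment of the edges of `T` to leaf cells is admissible if each edge lies in the closed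
square of its cell. (An edge that runs along a grid line is thereby put on one side of it.) -/
def SteinerTree.IsAdmissible {V : Finset (ℝ × ℝ)} (T : SteinerTree V) (D : ℝ)
    (cell : Sym2 (Fin T.n) → Cell) : Prop :=
  ∀ u v, T.G.Adj u v →
    IsLeaf D V (cell s(u, v)) ∧
      T.pos u ∈ (cell s(u, v)).square D ∧ T.pos v ∈ (cell s(u, v)).square D

/-- The tree crosses side `d` of the cell `Q` at its vertex `v`: the vertex lies on that side, one
of its edges is inside `Q`, and another one is on the other side of the line. -/
def SteinerTree.CrossesAt {V : Finset (ℝ × ℝ)} (T : SteinerTree V) (D : ℝ)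
    (cell : Sym2 (Fin T.n) → Cell) (Q : Cell) (d : Dir) (v : Fin T.n) : Prop :=
  T.pos v ∈ Q.side D d ∧
  ∃ u w, T.G.Adj v u ∧ T.G.Adj v w ∧
    (cell s(v, u)).square D ⊆ Q.square D ∧ Q.Beyond D d (cell s(v, w))

/-- `(m, r)`-light trees with respect to the quadtree of `V` with root cell `[0, D]²`: the tree is
composed of forests in the leaf cells, it crosses sides of quadtree cells only at portals, and
it crosses each side of each cell at most `r` times between the two corners of the side. -/
def SteinerTree.IsLight {V : Finset (ℝ × ℝ)} (T : SteinerTree V) (D : ℝ) (m r : ℕ) : Prop :=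
  ∃ cell : Sym2 (Fin T.n) → Cell, T.IsAdmissible D cell ∧
    ∀ Q d, InQuadtree D V Q →
      (∀ v, T.CrossesAt D cell Q d v → IsPortal D V m Q d (T.pos v)) ∧
      {v | T.CrossesAt D cell Q d v ∧ T.pos v ∈ Q.openSide D d}.ncard ≤ r

/-- The points of `V`, translated by the vector `(a, b)`. -/
noncomputable def shifted (V : Finset (ℤ × ℤ)) (a b : ℕ) : Finset (ℝ × ℝ) :=
  V.map ⟨fun p => ((p.1 : ℝ) + a, (p.2 : ℝ) + b), fun p q h => by
    simpa [Prod.ext_iff] using h⟩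

open Classical in
/-- The probability of an event for a pair of integer shifts drawn uniformly from `[0, L)²`. -/
noncomputable def shiftProb (L : ℕ) (E : ℕ → ℕ → Prop) : ℝ :=
  (((Finset.range L ×ˢ Finset.range L).filter fun s => E s.1 s.2).card : ℝ) / (L : ℝ) ^ 2

end RSMT

/-! The height of a grid line is the exponent of the largest power of two, at most `2 ^ k`, dividing
its coordinate. It determines how large the quadtree cells with a side on that line can be. A random
shift gives a fixed line height at least `h` with probability at most `2 ^ (-h)`, so a detour of
length `2 ^ h` made only on lines of height at least `h` costs at most 1 in expectation.

Rounding all coordinates with one random threshold preserves expected `ℓ₁`-length and fixes the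
terminals, so a tree may be replaced by unit grid edges (`exists_unit_edges`). Each unit edge makes
one crossing request on the perpendicular line at its right or upper end, so there are as many
requests as units of length.

On one line, dyadic blocks are treated from small to large. A block with more than `r` surviving
requests keeps one of them, and a strand runs along the block on both sides of the line. Such a
block discards at least `r` requests, so a request set `R` causes at most `|R| / r` of these blocks
over all heights (`sum_heavyBlocks_le`). Each survivor then moves to a portal in the smallest block
around it that contains one. This costs a constant number of portal distances, and nestedness of
blocks keeps at most `r` portals used per block (`portalOf_count`). A strand meets perpendicular
lines only in the interior of a block, so these have smaller height than its own line. It crosses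
them at points that are portals and never lie strictly between the corners of a side.

Every vertex of the construction carries a unit cell, which makes crossing a combinatorial notion.
Sending each edge to the leaf around its unit cell makes a spanning tree light
(`exists_light_tree`).

The request set of a vertical line depends only on the vertical shift, so the horizontal shift can
be averaged with the thinning fixed (`sum_lineBound_le`). With two sides per strand the expected
relative excess is at most `2 / r + 6 * k / m`, and Markov's inequality doubles it. -/

namespace RSMT

/-! ### Steiner trees from finite drawn graphs -/

/-- The graph whose edges are the listed pairs. -/
def pairGraph {N : Type*} (E : Finset (N × N)) : SimpleGraph N :=
  SimpleGraph.fromRel fun u v => (u, v) ∈ E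

theorem l1dist_nonneg (p q : ℝ × ℝ) : 0 ≤ l1dist p q :=
  add_nonneg (abs_nonneg _) (abs_nonneg _)

/-- The total length of a list of drawn edges. -/
noncomputable def pairLength {N : Type*} (pos : N → ℝ × ℝ) (E : Finset (N × N)) : ℝ :=
  ∑ e ∈ E, l1dist (pos e.1) (pos e.2)

theorem reachable_of_mem {N : Type*} {E : Finset (N × N)} {u v : N} (h : (u, v) ∈ E) :
    (pairGraph E).Reachable u v := by
  by_cases huv : u = v
  · subst huv; rfl
  · exact SimpleGraph.Adj.reachable (by simp [pairGraph, huv, h])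

/-- The vertex type may be infinite, but every vertex reached from `w₀`, other than `w₀`, is an end
of a listed pair. -/
theorem finite_component {N : Type*} (E : Finset (N × N)) (w₀ : N) :
    ((pairGraph E).connectedComponentMk w₀).supp.Finite := by
  classical
  refine Set.Finite.subset (s := ↑(insert w₀ (E.image Prod.fst ∪ E.image Prod.snd)))
    (Finset.finite_toSet _) ?_
  intro w hw
  rw [SimpleGraph.ConnectedComponent.mem_supp_iff, SimpleGraph.ConnectedComponent.eq] at hw
  obtain ⟨p⟩ := hw
  cases p with
  | nil => simp
  | cons h p =>
    simp only [pairGraph, SimpleGraph.fromRel_adj] at h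
    simp only [Finset.coe_insert, Finset.coe_union, Finset.coe_image, Set.mem_insert_iff,
      Set.mem_union, Set.mem_image, Finset.mem_coe]
    rcases h.2 with h | h
    · exact Or.inr (Or.inl ⟨_, h, rfl⟩)
    · exact Or.inr (Or.inr ⟨_, h, rfl⟩)

/-- A finite drawn graph contains a Steiner tree for all terminals reachable from one vertex. -/
theorem exists_steinerTree {N : Type*} (E : Finset (N × N)) (pos : N → ℝ × ℝ)
    (hax : ∀ e ∈ E, (pos e.1).1 = (pos e.2).1 ∨ (pos e.1).2 = (pos e.2).2)
    (V : Finset (ℝ × ℝ)) (w₀ : N)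
    (hV : ∀ p ∈ V, ∃ w, (pairGraph E).Reachable w₀ w ∧ pos w = p) :
    ∃ (T : SteinerTree V) (φ : Fin T.n → N), Function.Injective φ ∧
      (∀ v, T.pos v = pos (φ v)) ∧
      (∀ u v, T.G.Adj u v → (pairGraph E).Adj (φ u) (φ v)) ∧
      T.length ≤ pairLength pos E := by
  classical
  set G := pairGraph E with hG
  set C := G.connectedComponentMk w₀ with hC
  obtain ⟨S, hS, hST⟩ := C.connected_toSimpleGraph.exists_isTree_le
  have : Finite C := (finite_component E w₀).to_subtype
  obtain ⟨n, ⟨e⟩⟩ := Finite.exists_equiv_fin C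
  let φ : Fin n → N := fun i => (e.symm i).1
  have hφ : Function.Injective φ := Subtype.val_injective.comp e.symm.injective
  have hadj : ∀ u v, (S.comap e.symm).Adj u v → G.Adj (φ u) (φ v) := fun u v h => hS h
  have hE : ∀ {u v}, G.Adj u v → (u, v) ∈ E ∨ (v, u) ∈ E := by
    intro u v h
    simp only [hG, pairGraph, SimpleGraph.fromRel_adj] at h
    exact h.2
  let T : SteinerTree V :=
    { n := n
      G := S.comap e.symm
      isTree := (SimpleGraph.Iso.comap e.symm S).isTree_iff.2 hST
      pos := fun i => pos (φ i)
      spans := by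
        intro p hp
        obtain ⟨w, hw, rfl⟩ := hV p hp
        refine ⟨e ⟨w, ?_⟩, ?_⟩
        · exact (SimpleGraph.ConnectedComponent.eq.2 hw.symm)
        · simp [φ]
      axisParallel := by
        intro u v h
        rcases hE (hadj u v h) with h | h
        · exact hax _ h
        · exact (hax _ h).imp Eq.symm Eq.symm }
  refine ⟨T, φ, hφ, fun _ => rfl, hadj, ?_⟩
  let len : Sym2 N → ℝ :=
    Sym2.lift ⟨fun u v => l1dist (pos u) (pos v), fun _ _ => l1dist_comm _ _⟩
  have h1 : T.length = ∑ x ∈ T.G.edgeFinset.image (Sym2.map φ), len x := by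
    rw [Finset.sum_image (fun a _ b _ h => Sym2.map.injective hφ h)]
    unfold SteinerTree.length
    refine Finset.sum_congr (by ext; simp) fun x _ => ?_
    induction x with
    | _ u v => rfl
  have hlen : ∀ x, 0 ≤ len x := by
    intro x
    induction x with
    | _ u v => exact l1dist_nonneg _ _
  rw [h1]
  calc ∑ x ∈ T.G.edgeFinset.image (Sym2.map φ), len x
      ≤ ∑ x ∈ E.image (fun e => s(e.1, e.2)), len x := by
        refine Finset.sum_le_sum_of_subset_of_nonneg ?_ fun x _ _ => hlen x
        intro x hx
        simp only [Finset.mem_image, SimpleGraph.mem_edgeFinset] at hx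
        obtain ⟨y, hy, rfl⟩ := hx
        induction y with
        | _ u v =>
          rcases hE (hadj u v hy) with h | h
          · exact Finset.mem_image.2 ⟨_, h, rfl⟩
          · exact Finset.mem_image.2 ⟨_, h, Sym2.eq_swap⟩
    _ ≤ ∑ e ∈ E, len s(e.1, e.2) := Finset.sum_image_le_of_nonneg fun x _ => hlen x
    _ = pairLength pos E := rfl

theorem pairLength_union_le {N : Type*} [DecidableEq N] (pos : N → ℝ × ℝ) (E F : Finset (N × N)) :
    pairLength pos (E ∪ F) ≤ pairLength pos E + pairLength pos F := by
  unfold pairLength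
  rw [← Finset.sum_union_inter]
  exact le_add_of_nonneg_right (Finset.sum_nonneg fun _ _ => l1dist_nonneg _ _)

theorem pairLength_biUnion_le {N ι : Type*} [DecidableEq N] [DecidableEq ι]
    (pos : N → ℝ × ℝ) (s : Finset ι) (E : ι → Finset (N × N)) :
    pairLength pos (s.biUnion E) ≤ ∑ i ∈ s, pairLength pos (E i) := by
  induction s using Finset.induction_on with
  | empty => simp [pairLength]
  | insert i s hi ih =>
    rw [Finset.biUnion_insert, Finset.sum_insert hi]
    exact (pairLength_union_le _ _ _).trans (by gcongr)

theorem pairLength_insert_le {N : Type*} [DecidableEq N] (pos : N → ℝ × ℝ) (e : N × N)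
    (E : Finset (N × N)) :
    pairLength pos (insert e E) ≤ l1dist (pos e.1) (pos e.2) + pairLength pos E := by
  rw [Finset.insert_eq]
  exact (pairLength_union_le _ _ _).trans (by simp [pairLength])

/-! ### Rounding a Steiner tree to the unit grid -/

open MeasureTheory

/-- The unit grid edges, horizontal ones given by their left endpoints in `H` and vertical ones
given by their lower endpoints in `K`, connect all points of `V`. -/
def Connects (H K : Finset (ℤ × ℤ)) (V : Finset (ℤ × ℤ)) : Prop :=
  ∀ s : Setoid (ℤ × ℤ), (∀ p ∈ H, s p (p.1 + 1, p.2)) → (∀ p ∈ K, s p (p.1, p.2 + 1)) →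
    ∀ p ∈ V, ∀ q ∈ V, s p q

theorem nonempty_steinerTree (V : Finset (ℝ × ℝ)) : Nonempty (SteinerTree V) := by
  classical
  let E : Finset ((ℝ × ℝ) × (ℝ × ℝ)) :=
    V.image (fun p => (p, (p.1, 0))) ∪ V.image (fun p => ((p.1, 0), (0, 0)))
  obtain ⟨T, -⟩ := exists_steinerTree E id (by
    intro e he
    simp only [E, Finset.mem_union, Finset.mem_image] at he
    rcases he with ⟨p, -, rfl⟩ | ⟨p, -, rfl⟩ <;> simp) V (0, 0) (by
    intro p hp
    have h1 : (p, ((p.1, 0) : ℝ × ℝ)) ∈ E :=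
      Finset.mem_union_left _ (Finset.mem_image_of_mem (fun p : ℝ × ℝ => (p, ((p.1, 0) : ℝ × ℝ))) hp)
    have h2 : (((p.1, 0) : ℝ × ℝ), ((0, 0) : ℝ × ℝ)) ∈ E :=
      Finset.mem_union_right _ (Finset.mem_image_of_mem
        (fun p : ℝ × ℝ => (((p.1, 0) : ℝ × ℝ), ((0, 0) : ℝ × ℝ))) hp)
    exact ⟨p, ((reachable_of_mem h1).trans (reachable_of_mem h2)).symm, rfl⟩)
  exact ⟨T⟩

theorem monotone_floor_add (x : ℝ) : Monotone fun θ : ℝ => (⌊x + θ⌋ : ℝ) := by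
  intro a b h
  exact Int.cast_le.2 (Int.floor_mono (add_le_add_right h x))

theorem integrableOn_floor_add (x : ℝ) :
    IntegrableOn (fun θ : ℝ => (⌊x + θ⌋ : ℝ)) (Set.Ioo 0 1) := by
  have h := (monotone_floor_add x).intervalIntegrable (μ := volume) (a := 0) (b := 1)
  rw [intervalIntegrable_iff_integrableOn_Ioo_of_le zero_le_one] at h
  exact h

/-- The floor is the identity minus the fractional part, whose integral over a period does not
depend on `x`. The constant on the right is left unevaluated because it cancels in differences. -/
theorem integral_floor_add (x : ℝ) :
    ∫ θ in Set.Ioo (0 : ℝ) 1, (⌊x + θ⌋ : ℝ) = x + ∫ θ in (0 : ℝ)..1, (⌊θ⌋ : ℝ) := by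
  have key : ∀ x : ℝ, ∫ θ in (0 : ℝ)..1, (⌊x + θ⌋ : ℝ) =
      x + 1 / 2 - ∫ θ in (0 : ℝ)..1, Int.fract θ := by
    intro x
    have hper : ∫ θ in (0 : ℝ)..1, Int.fract (x + θ) = ∫ θ in (0 : ℝ)..1, Int.fract θ := by
      rw [intervalIntegral.integral_comp_add_left (fun t => Int.fract t) x]
      have := (Int.fract_periodic ℝ).intervalIntegral_add_eq x 0
      simpa using this
    have hi : IntervalIntegrable (fun θ : ℝ => (⌊x + θ⌋ : ℝ)) volume 0 1 :=
      (monotone_floor_add x).intervalIntegrable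
    have hl : IntervalIntegrable (fun θ : ℝ => x + θ) volume 0 1 :=
      (continuous_const.add continuous_id).intervalIntegrable _ _
    have hs : ∫ θ in (0 : ℝ)..1, Int.fract (x + θ) =
        (∫ θ in (0 : ℝ)..1, (x + θ)) - ∫ θ in (0 : ℝ)..1, (⌊x + θ⌋ : ℝ) := by
      rw [← intervalIntegral.integral_sub hl hi]
      rfl
    have hx : ∫ θ in (0 : ℝ)..1, (x + θ) = x + 1 / 2 := by
      rw [intervalIntegral.integral_add (by simp) (by simp)]
      simp
    linarith
  have h0 := key 0
  simp only [zero_add] at h0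
  rw [← integral_Ioc_eq_integral_Ioo, ← intervalIntegral.integral_of_le zero_le_one, key x, h0]
  ring

theorem integrableOn_abs_floor_sub (x y : ℝ) :
    IntegrableOn (fun θ : ℝ => |(⌊x + θ⌋ : ℝ) - ⌊y + θ⌋|) (Set.Ioo 0 1) :=
  ((integrableOn_floor_add x).sub (integrableOn_floor_add y)).abs

theorem integral_abs_floor_sub (x y : ℝ) :
    ∫ θ in Set.Ioo (0 : ℝ) 1, |(⌊x + θ⌋ : ℝ) - ⌊y + θ⌋| = |x - y| := by
  wlog h : y ≤ x generalizing x y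
  · rw [abs_sub_comm, ← this y x (le_of_not_ge h)]
    simp_rw [abs_sub_comm]
  have : ∀ θ : ℝ, |(⌊x + θ⌋ : ℝ) - ⌊y + θ⌋| = (⌊x + θ⌋ : ℝ) - ⌊y + θ⌋ := fun θ =>
    abs_of_nonneg (sub_nonneg.2 (by exact_mod_cast Int.floor_mono (by linarith)))
  simp_rw [this]
  rw [integral_sub (integrableOn_floor_add x) (integrableOn_floor_add y), integral_floor_add,
    integral_floor_add, abs_of_nonneg (sub_nonneg.2 h)]
  ring

/-- Rounding real numbers by a common random threshold does not increase distances on average. -/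
theorem exists_floor_sum_le {ι : Type*} (s : Finset ι) (x y : ι → ℝ) :
    ∃ θ ∈ Set.Ioo (0 : ℝ) 1,
      ∑ i ∈ s, |(⌊x i + θ⌋ : ℝ) - ⌊y i + θ⌋| ≤ ∑ i ∈ s, |x i - y i| := by
  have hint : IntegrableOn (fun θ : ℝ => ∑ i ∈ s, |(⌊x i + θ⌋ : ℝ) - ⌊y i + θ⌋|) (Set.Ioo 0 1) :=
    integrable_finsetSum _ fun i _ => integrableOn_abs_floor_sub _ _
  obtain ⟨θ, hθ, h⟩ := exists_le_setAverage (μ := volume) (s := Set.Ioo (0 : ℝ) 1)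
    (by simp) (by simp) hint
  refine ⟨θ, hθ, h.trans (le_of_eq ?_)⟩
  rw [setAverage_eq, integral_finsetSum _ fun i _ => integrableOn_abs_floor_sub _ _]
  simp [integral_abs_floor_sub, measureReal_def]

theorem setoid_of_steps (s : Setoid ℤ) (a b : ℤ) (hab : a ≤ b)
    (h : ∀ z, a ≤ z → z < b → s z (z + 1)) : s a b := by
  induction b, hab using Int.leInduction with
  | base => exact s.refl _
  | succ b hb ih =>
    exact s.trans (ih fun z h1 h2 => h z h1 (by omega)) (h b hb (by omega))

/-- The unit horizontal edges of the segment between two points of a horizontal line. -/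
noncomputable def segmentEdges (p q : ℤ × ℤ) : Finset (ℤ × ℤ) :=
  if p.2 = q.2 then Finset.Ico (min p.1 q.1) (max p.1 q.1) ×ˢ {p.2} else ∅

theorem card_segmentEdges_le (p q : ℤ × ℤ) : ((segmentEdges p q).card : ℝ) ≤ |(p.1 : ℝ) - q.1| := by
  unfold segmentEdges
  split_ifs
  · simp only [Finset.card_product, Int.card_Ico, Finset.card_singleton, mul_one]
    rw [max_sub_min_eq_abs']
    rw [← Int.cast_sub, ← Int.cast_abs]
    exact_mod_cast (Int.toNat_of_nonneg (abs_nonneg _)).le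
  · simp

theorem setoid_of_segmentEdges (s : Setoid (ℤ × ℤ)) (p q : ℤ × ℤ) (hpq : p.2 = q.2)
    (h : ∀ z ∈ segmentEdges p q, s z (z.1 + 1, z.2)) : s p q := by
  have key : ∀ p q : ℤ × ℤ, p.2 = q.2 → p.1 ≤ q.1 →
      (∀ z, p.1 ≤ z → z < q.1 → s (z, p.2) (z + 1, p.2)) → s p q := by
    intro p q h2 h1 h
    have := setoid_of_steps (s.comap fun z => (z, p.2)) p.1 q.1 h1 h
    have h3 : s (p.1, p.2) (q.1, p.2) := this
    rw [show q = (q.1, p.2) from Prod.ext rfl h2.symm]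
    exact h3
  have hm : ∀ z, min p.1 q.1 ≤ z → z < max p.1 q.1 → s (z, p.2) (z + 1, p.2) := by
    intro z h1 h2
    exact h (z, p.2) (by simp only [segmentEdges, hpq, if_true, Finset.mem_product, Finset.mem_Ico,
      Finset.mem_singleton]; exact ⟨⟨h1, h2⟩, trivial⟩)
  rcases le_total p.1 q.1 with hle | hle
  · exact key p q hpq hle fun z h1 h2 => hm z (by simp [h1]) (by simp [h2])
  · refine s.symm (key q p hpq.symm hle fun z h1 h2 => ?_)
    rw [← hpq]
    exact hm z (by simp [h1]) (by simp [h2])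

theorem mem_segmentEdges_bounds {p q z : ℤ × ℤ} {B : ℤ} (h : z ∈ segmentEdges p q)
    (hp : 0 ≤ p.1 ∧ p.1 ≤ B ∧ 0 ≤ p.2 ∧ p.2 ≤ B) (hq : 0 ≤ q.1 ∧ q.1 ≤ B ∧ 0 ≤ q.2 ∧ q.2 ≤ B) :
    0 ≤ z.1 ∧ z.1 + 1 ≤ B ∧ 0 ≤ z.2 ∧ z.2 ≤ B := by
  unfold segmentEdges at h
  split_ifs at h with h2
  · simp only [Finset.mem_product, Finset.mem_Ico, Finset.mem_singleton] at h
    omega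
  · simp at h

/-- Rounding sends equal coordinates to equal integers, so each edge stays axis-parallel and splits
into unit edges, as many as its rounded length. Overlaps only reduce the count. -/
theorem exists_unit_edges_of_tree (L : ℕ) (V : Finset (ℤ × ℤ))
    (hV : ∀ p ∈ V, 0 ≤ p.1 ∧ p.1 ≤ L ∧ 0 ≤ p.2 ∧ p.2 ≤ L) (T : SteinerTree (shifted V 0 0)) :
    ∃ H K : Finset (ℤ × ℤ), Connects H K V ∧
      (∀ p ∈ H, 0 ≤ p.1 ∧ p.1 + 1 ≤ L ∧ 0 ≤ p.2 ∧ p.2 ≤ L) ∧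
      (∀ p ∈ K, 0 ≤ p.1 ∧ p.1 ≤ L ∧ 0 ≤ p.2 ∧ p.2 + 1 ≤ L) ∧
      ((H.card + K.card : ℕ) : ℝ) ≤ T.length := by
  classical
  -- Clamping to `[0, L]` is 1-Lipschitz and fixes the coordinates of terminals. It keeps the
  -- rounded tree inside the square.
  let c : ℝ → ℝ := fun x => max 0 (min x L)
  have hc : ∀ x y, |c x - c y| ≤ |x - y| := fun x y =>
    (abs_max_sub_max_le_max _ _ _ _).trans (by
      simp only [sub_self, abs_zero]
      refine max_le (abs_nonneg _) ((abs_min_sub_min_le_max _ _ _ _).trans ?_)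
      simp)
  let a : Sym2 (Fin T.n) → Fin T.n := fun e => e.out.1
  let b : Sym2 (Fin T.n) → Fin T.n := fun e => e.out.2
  have hab : ∀ e, s(a e, b e) = e := fun e => Quot.out_eq e
  -- The Boolean index selects a coordinate: one sum over both coordinates yields a single threshold
  -- for all of them.
  obtain ⟨θ, ⟨hθ0, hθ1⟩, hθ⟩ := exists_floor_sum_le (T.G.edgeFinset ×ˢ (Finset.univ : Finset Bool))
    (fun i => c (if i.2 then (T.pos (a i.1)).1 else (T.pos (a i.1)).2))
    (fun i => c (if i.2 then (T.pos (b i.1)).1 else (T.pos (b i.1)).2))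
  rw [Finset.sum_product, Finset.sum_product] at hθ
  simp only [Fintype.sum_bool, if_true, Bool.false_eq_true, if_false] at hθ
  let ρ : ℝ → ℤ := fun x => ⌊c x + θ⌋
  have hρ0 : ∀ x, 0 ≤ ρ x := fun x => Int.floor_nonneg.2 (add_nonneg (le_max_left _ _) hθ0.le)
  have hρL : ∀ x, ρ x ≤ L := by
    intro x
    have h1 : c x ≤ L := max_le (Nat.cast_nonneg _) (min_le_right _ _)
    have h2 : ρ x < (L : ℤ) + 1 := Int.floor_lt.2 (by push_cast; linarith)
    omega
  have hρz : ∀ z : ℤ, 0 ≤ z → z ≤ L → ρ z = z := by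
    intro z h0 h1
    have h2 : c z = z := by
      have h0' : (0 : ℝ) ≤ z := by exact_mod_cast h0
      have h1' : (z : ℝ) ≤ L := by exact_mod_cast h1
      simp [c, h0', h1']
    simp only [ρ, h2]
    rw [Int.floor_eq_iff]
    constructor <;> linarith
  let π : Fin T.n → ℤ × ℤ := fun v => (ρ (T.pos v).1, ρ (T.pos v).2)
  let H := T.G.edgeFinset.biUnion fun e => segmentEdges (π (a e)) (π (b e))
  let K := (T.G.edgeFinset.biUnion fun e =>
    segmentEdges (π (a e)).swap (π (b e)).swap).image Prod.swap
  refine ⟨H, K, ?_, ?_, ?_, ?_⟩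
  · intro s hH hK
    have hadj' : ∀ e ∈ T.G.edgeFinset, s (π (a e)) (π (b e)) := by
      intro e he
      have hax := T.axisParallel (a e) (b e) (by
        rw [← SimpleGraph.mem_edgeSet, hab]; exact SimpleGraph.mem_edgeFinset.1 he)
      rcases hax with h | h
      · have h' := setoid_of_segmentEdges (s.comap Prod.swap) (π (a e)).swap (π (b e)).swap
          (by simp [π, h]) (by
            intro z hz
            exact hK z.swap (Finset.mem_image_of_mem _ (Finset.mem_biUnion.2 ⟨e, he, hz⟩)))
        simpa [Setoid.comap_rel] using h'
      · exact setoid_of_segmentEdges s (π (a e)) (π (b e)) (by simp [π, h]) fun z hz =>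
          hH z (Finset.mem_biUnion.2 ⟨e, he, hz⟩)
    have hadj : ∀ u v, T.G.Adj u v → s (π u) (π v) := by
      intro u v h
      have h1 := hadj' s(u, v) (by simpa using h)
      have h2 := hab s(u, v)
      rw [Sym2.eq_iff] at h2
      rcases h2 with ⟨h2, h3⟩ | ⟨h2, h3⟩
      · rwa [h2, h3] at h1
      · rw [h2, h3] at h1; exact s.symm h1
    have hreach : ∀ u v, s (π u) (π v) := by
      intro u v
      obtain ⟨p⟩ := T.isTree.connected.preconnected u v
      induction p with
      | nil => exact s.refl _
      | cons h _ ih => exact s.trans (hadj _ _ h) ih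
    have hrep : ∀ p ∈ V, ∃ v, π v = p := by
      intro p hp
      obtain ⟨v, hv⟩ := T.spans ((p.1 : ℝ), (p.2 : ℝ)) (by
        simp only [shifted, Finset.mem_map]
        exact ⟨p, hp, by simp⟩)
      obtain ⟨h1, h2, h3, h4⟩ := hV p hp
      exact ⟨v, by simp [π, hv, hρz _ h1 h2, hρz _ h3 h4]⟩
    intro p hp q hq
    obtain ⟨u, rfl⟩ := hrep p hp
    obtain ⟨v, rfl⟩ := hrep q hq
    exact hreach u v
  · intro p hp
    obtain ⟨e, -, h⟩ := Finset.mem_biUnion.1 hp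
    exact mem_segmentEdges_bounds h ⟨hρ0 _, hρL _, hρ0 _, hρL _⟩ ⟨hρ0 _, hρL _, hρ0 _, hρL _⟩
  · intro p hp
    obtain ⟨z, hz, rfl⟩ := Finset.mem_image.1 hp
    obtain ⟨e, -, h⟩ := Finset.mem_biUnion.1 hz
    have := mem_segmentEdges_bounds h ⟨hρ0 _, hρL _, hρ0 _, hρL _⟩ ⟨hρ0 _, hρL _, hρ0 _, hρL _⟩
    exact ⟨this.2.2.1, this.2.2.2, this.1, this.2.1⟩
  · have hH : (H.card : ℝ) ≤ ∑ e ∈ T.G.edgeFinset, |((π (a e)).1 : ℝ) - (π (b e)).1| := by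
      refine le_trans (Nat.cast_le.2 Finset.card_biUnion_le) ?_
      push_cast
      exact Finset.sum_le_sum fun e _ => card_segmentEdges_le _ _
    have hK : (K.card : ℝ) ≤ ∑ e ∈ T.G.edgeFinset, |((π (a e)).2 : ℝ) - (π (b e)).2| := by
      refine le_trans (Nat.cast_le.2 (Finset.card_image_le.trans Finset.card_biUnion_le)) ?_
      push_cast
      exact Finset.sum_le_sum fun e _ => card_segmentEdges_le _ _
    have hlen : T.length = ∑ e ∈ T.G.edgeFinset, l1dist (T.pos (a e)) (T.pos (b e)) := by
      unfold SteinerTree.length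
      refine Finset.sum_congr (by ext; simp) fun e _ => ?_
      conv_lhs => rw [← hab e]
      rfl
    rw [hlen]
    push_cast
    refine (add_le_add hH hK).trans ?_
    rw [← Finset.sum_add_distrib]
    refine le_trans hθ (Finset.sum_le_sum fun e _ => add_le_add (hc _ _) (hc _ _))

/-- Some minimum set of connecting unit grid edges is no longer than a minimum Steiner tree. -/
theorem exists_unit_edges (L : ℕ) (V : Finset (ℤ × ℤ))
    (hV : ∀ p ∈ V, 0 ≤ p.1 ∧ p.1 ≤ L ∧ 0 ≤ p.2 ∧ p.2 ≤ L) :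
    ∃ H K : Finset (ℤ × ℤ), Connects H K V ∧
      (∀ p ∈ H, 0 ≤ p.1 ∧ p.1 + 1 ≤ L ∧ 0 ≤ p.2 ∧ p.2 ≤ L) ∧
      (∀ p ∈ K, 0 ≤ p.1 ∧ p.1 ≤ L ∧ 0 ≤ p.2 ∧ p.2 + 1 ≤ L) ∧
      ((H.card + K.card : ℕ) : ℝ) ≤ opt (shifted V 0 0) := by
  classical
  -- Edge counts are natural numbers, so a minimum exists. It is at most the length of every tree,
  -- hence at most the infimum, and no optimal tree is needed.
  let P : ℕ → Prop := fun c => ∃ H K : Finset (ℤ × ℤ), Connects H K V ∧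
      (∀ p ∈ H, 0 ≤ p.1 ∧ p.1 + 1 ≤ L ∧ 0 ≤ p.2 ∧ p.2 ≤ L) ∧
      (∀ p ∈ K, 0 ≤ p.1 ∧ p.1 ≤ L ∧ 0 ≤ p.2 ∧ p.2 + 1 ≤ L) ∧ H.card + K.card = c
  obtain ⟨T₀⟩ := nonempty_steinerTree (shifted V 0 0)
  have hP : ∃ c, P c := by
    obtain ⟨H, K, h1, h2, h3, -⟩ := exists_unit_edges_of_tree L V hV T₀
    exact ⟨_, H, K, h1, h2, h3, rfl⟩
  obtain ⟨H, K, h1, h2, h3, h4⟩ := Nat.find_spec hP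
  refine ⟨H, K, h1, h2, h3, le_csInf ⟨_, T₀, rfl⟩ ?_⟩
  rintro _ ⟨T, rfl⟩
  obtain ⟨H', K', h1', h2', h3', h4'⟩ := exists_unit_edges_of_tree L V hV T
  refine le_trans ?_ h4'
  rw [h4]
  exact_mod_cast Nat.find_min' hP ⟨H', K', h1', h2', h3', rfl⟩

/-! ### Thinning crossing requests in dyadic blocks of a line -/

theorem ediv_pow_mono {y z : ℤ} {g h : ℕ} (hgh : g ≤ h) (hyz : y / 2 ^ g = z / 2 ^ g) :
    y / 2 ^ h = z / 2 ^ h := by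
  obtain ⟨d, rfl⟩ := Nat.exists_eq_add_of_le hgh
  rw [pow_add, ← Int.ediv_ediv_of_nonneg (by positivity), ← Int.ediv_ediv_of_nonneg (by positivity),
    hyz]

theorem ediv_pow_eq_iff {y q : ℤ} {h : ℕ} :
    y / 2 ^ h = q ↔ q * 2 ^ h ≤ y ∧ y < (q + 1) * 2 ^ h := by
  have hp : (0 : ℤ) < 2 ^ h := by positivity
  rw [← Int.le_ediv_iff_mul_le hp, ← Int.ediv_lt_iff_lt_mul hp]
  omega

/-- A multiple of `2 ^ h` starts a new block of height `h`. This is why strands meet only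
perpendicular lines of smaller height. -/
theorem not_dvd_of_ediv_eq {z : ℤ} {h : ℕ} (hz : z / 2 ^ h = (z + 1) / 2 ^ h) :
    ¬ (2 : ℤ) ^ h ∣ z + 1 := by
  rintro ⟨c, hc⟩
  have hp : (0 : ℤ) < 2 ^ h := by positivity
  have h1 : (z + 1) / 2 ^ h = c := by rw [hc]; exact Int.mul_ediv_cancel_left _ hp.ne'
  rw [h1, ediv_pow_eq_iff] at hz
  nlinarith

/-- The points of `A` in the block of height `h` and index `q`. -/
noncomputable def inBlock (A : Finset ℤ) (h : ℕ) (q : ℤ) : Finset ℤ := A.filter fun z => z / 2 ^ h = q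

/-- The indices of the blocks of height `h` with more than `r` points of `A`. -/
noncomputable def heavy (r h : ℕ) (A : Finset ℤ) : Finset ℤ :=
  (A.image fun y => y / 2 ^ h).filter fun q => r < (inBlock A h q).card

/-- Keep only the smallest point of `A` in each block of height `h` with more than `r` points. -/
noncomputable def thin (r h : ℕ) (A : Finset ℤ) : Finset ℤ :=
  A.filter fun y => (inBlock A h (y / 2 ^ h)).card ≤ r ∨ ∀ z ∈ A, z / 2 ^ h = y / 2 ^ h → y ≤ z

theorem thin_subset (r h : ℕ) (A : Finset ℤ) : thin r h A ⊆ A := Finset.filter_subset _ _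

theorem inBlock_thin_card_le_one {r h : ℕ} {A : Finset ℤ} {q : ℤ}
    (hq : r < (inBlock A h q).card) : (inBlock (thin r h A) h q).card ≤ 1 := by
  have key : ∀ a ∈ inBlock (thin r h A) h q, a ∈ A ∧ a / 2 ^ h = q ∧
      ∀ z ∈ A, z / 2 ^ h = q → a ≤ z := by
    intro a ha
    obtain ⟨hat, rfl⟩ := Finset.mem_filter.1 ha
    obtain ⟨haA, h1⟩ := Finset.mem_filter.1 hat
    exact ⟨haA, rfl, h1.resolve_left (not_le.2 hq)⟩
  refine Finset.card_le_one.2 fun a ha b hb => ?_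
  obtain ⟨ha1, ha2, ha3⟩ := key a ha
  obtain ⟨hb1, hb2, hb3⟩ := key b hb
  exact le_antisymm (ha3 b hb1 hb2) (hb3 a ha1 ha2)

theorem inBlock_thin_card_le {r : ℕ} (hr : 0 < r) (h : ℕ) (A : Finset ℤ) (q : ℤ) :
    (inBlock (thin r h A) h q).card ≤ r := by
  rcases lt_or_ge r (inBlock A h q).card with hq | hq
  · exact (inBlock_thin_card_le_one hq).trans hr
  · exact (Finset.card_le_card (Finset.filter_subset_filter _ (thin_subset r h A))).trans hq

/-- A heavy block has at least `r + 1` points and keeps at most one, so it pays for itself with `r`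
deleted points. -/
theorem card_thin_add_le (r h : ℕ) (A : Finset ℤ) :
    r * (heavy r h A).card + (thin r h A).card ≤ A.card := by
  have h1 : A.card = ∑ q ∈ A.image (fun y => y / 2 ^ h), (inBlock A h q).card :=
    Finset.card_eq_sum_card_image _ _
  have h2 : (thin r h A).card =
      ∑ q ∈ A.image (fun y => y / 2 ^ h), (inBlock (thin r h A) h q).card :=
    Finset.card_eq_sum_card_fiberwise fun y hy =>
      Finset.mem_image_of_mem (fun y : ℤ => y / 2 ^ h) (thin_subset r h A hy)
  rw [h1, h2, mul_comm, ← smul_eq_mul, ← Finset.sum_const, heavy, Finset.sum_filter,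
    ← Finset.sum_add_distrib]
  refine Finset.sum_le_sum fun q _ => ?_
  split_ifs with hq
  · have := inBlock_thin_card_le_one hq
    omega
  · rw [zero_add]
    exact Finset.card_le_card (Finset.filter_subset_filter _ (thin_subset r h A))

theorem exists_mem_thin {r h : ℕ} {A : Finset ℤ} {y : ℤ} (hy : y ∈ A) :
    ∃ v ∈ thin r h A, v = y ∨ (v / 2 ^ h = y / 2 ^ h ∧ y / 2 ^ h ∈ heavy r h A) := by
  rcases le_or_gt (inBlock A h (y / 2 ^ h)).card r with hle | hgt
  · exact ⟨y, Finset.mem_filter.2 ⟨hy, Or.inl hle⟩, Or.inl rfl⟩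
  · have hne : (inBlock A h (y / 2 ^ h)).Nonempty := ⟨y, Finset.mem_filter.2 ⟨hy, rfl⟩⟩
    obtain ⟨w, hw, hmin⟩ := Finset.exists_min_image _ id hne
    obtain ⟨hA, hb⟩ := Finset.mem_filter.1 hw
    refine ⟨w, Finset.mem_filter.2 ⟨hA, Or.inr fun z hz hzq => ?_⟩, Or.inr ⟨hb, ?_⟩⟩
    · exact hmin z (Finset.mem_filter.2 ⟨hz, hzq.trans hb⟩)
    · exact Finset.mem_filter.2 ⟨Finset.mem_image_of_mem (fun y : ℤ => y / 2 ^ h) hy, hgt⟩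

/-- The points that remain after thinning all blocks of heights `1, …, h` in this order. -/
noncomputable def reps (r : ℕ) (R : Finset ℤ) : ℕ → Finset ℤ
  | 0 => R
  | h + 1 => thin r (h + 1) (reps r R h)

/-- The blocks of height `h + 1` that are thinned. -/
noncomputable def heavyBlocks (r : ℕ) (R : Finset ℤ) (h : ℕ) : Finset ℤ := heavy r (h + 1) (reps r R h)

theorem reps_antitone (r : ℕ) (R : Finset ℤ) : Antitone (reps r R) :=
  antitone_nat_of_succ_le fun h => thin_subset r (h + 1) (reps r R h)

theorem reps_subset (r : ℕ) (R : Finset ℤ) (h : ℕ) : reps r R h ⊆ R :=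
  reps_antitone r R (Nat.zero_le h)

/-- Thinning at larger heights only deletes points, so the bound reached at height `g` persists. At
height 0 a block is a single integer. -/
theorem inBlock_reps_card_le {r : ℕ} (hr : 0 < r) (R : Finset ℤ) {g h : ℕ} (hgh : g ≤ h) (q : ℤ) :
    (inBlock (reps r R h) g q).card ≤ r := by
  refine (Finset.card_le_card (Finset.filter_subset_filter _ (reps_antitone r R hgh))).trans ?_
  cases g with
  | zero =>
    refine le_trans (Finset.card_le_one.2 fun a ha b hb => ?_) hr
    simp only [pow_zero, Int.ediv_one, Finset.mem_filter] at ha hb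
    rw [ha.2, hb.2]
  | succ g => exact inBlock_thin_card_le hr _ _ _

/-- The deletions telescope over the heights. The resulting bound on the number of heavy blocks does
not involve `h`, which is what produces a term in `1 / r` without a logarithm. -/
theorem sum_heavyBlocks_le (r : ℕ) (R : Finset ℤ) (h : ℕ) :
    r * (∑ g ∈ Finset.range h, (heavyBlocks r R g).card) + (reps r R h).card ≤ R.card := by
  induction h with
  | zero => simp [reps]
  | succ h ih =>
    rw [Finset.sum_range_succ, mul_add]
    have := card_thin_add_le r (h + 1) (reps r R h)
    simp only [reps, heavyBlocks] at *
    omega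

/-- The lower endpoints of the unit steps inside a block. -/
noncomputable def blockSteps (h : ℕ) (q : ℤ) : Finset ℤ := Finset.Ico (q * 2 ^ h) ((q + 1) * 2 ^ h - 1)

theorem mem_blockSteps {h : ℕ} {q z : ℤ} :
    z ∈ blockSteps h q ↔ z / 2 ^ h = q ∧ (z + 1) / 2 ^ h = q := by
  rw [blockSteps, Finset.mem_Ico, ediv_pow_eq_iff, ediv_pow_eq_iff]
  omega

theorem card_blockSteps (h : ℕ) (q : ℤ) : (blockSteps h q).card = 2 ^ h - 1 := by
  rw [blockSteps, Int.card_Ico]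
  have : (q + 1) * 2 ^ h - 1 - q * 2 ^ h = ((2 ^ h - 1 : ℕ) : ℤ) := by
    rw [Nat.cast_sub Nat.one_le_two_pow]
    push_cast
    ring
  rw [this, Int.toNat_natCast]

theorem setoid_of_blockSteps (s : Setoid ℤ) {h : ℕ} {y v : ℤ} (hyv : v / 2 ^ h = y / 2 ^ h)
    (hs : ∀ z ∈ blockSteps h (y / 2 ^ h), s z (z + 1)) : s y v := by
  have key : ∀ a b : ℤ, a ≤ b → a / 2 ^ h = y / 2 ^ h → b / 2 ^ h = y / 2 ^ h → s a b := by
    intro a b hab ha hb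
    refine setoid_of_steps s a b hab fun z h1 h2 => hs z ?_
    rw [ediv_pow_eq_iff] at ha hb
    rw [blockSteps, Finset.mem_Ico]
    omega
  rcases le_total y v with hle | hle
  · exact key y v hle rfl hyv
  · exact s.symm (key v y hle hyv rfl)

/-! ### Moving crossings to portals -/

/-- The smallest multiple of `δ` that is at least `c`. -/
noncomputable def firstPortal (δ : ℝ) (c : ℤ) : ℝ := ⌈(c : ℝ) / δ⌉ * δ

theorem le_firstPortal {δ : ℝ} (hδ : 0 < δ) (c : ℤ) : (c : ℝ) ≤ firstPortal δ c := by
  have := Int.le_ceil ((c : ℝ) / δ)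
  rwa [div_le_iff₀ hδ] at this

theorem firstPortal_lt {δ : ℝ} (hδ : 0 < δ) (c : ℤ) : firstPortal δ c < c + δ := by
  have h := Int.ceil_lt_add_one ((c : ℝ) / δ)
  have h2 := mul_lt_mul_of_pos_right h hδ
  rw [add_mul, div_mul_cancel₀ _ hδ.ne', one_mul] at h2
  exact h2

/-- The lower end of the block of height `h` that contains `v`. -/
def blockStart (h : ℕ) (v : ℤ) : ℤ := v / 2 ^ h * 2 ^ h

theorem blockStart_ediv (h : ℕ) (v : ℤ) : blockStart h v / 2 ^ h = v / 2 ^ h :=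
  Int.mul_ediv_cancel _ (by positivity)

/-- The distance of portals on a line of height `H`. -/
noncomputable def spacing (m H : ℕ) : ℝ := 2 ^ H / (m + 1)

theorem spacing_pos (m H : ℕ) : 0 < spacing m H := by unfold spacing; positivity

theorem firstPortal_blockStart_of_le {m H h : ℕ} (hh : H ≤ h) (v : ℤ) :
    firstPortal (spacing m H) (blockStart h v) = blockStart h v := by
  obtain ⟨d, rfl⟩ := Nat.exists_eq_add_of_le hh
  have : ((blockStart (H + d) v : ℤ) : ℝ) / spacing m H =
      ((v / 2 ^ (H + d) * 2 ^ d * (m + 1) : ℤ) : ℝ) := by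
    unfold spacing blockStart
    push_cast
    field_simp
    ring
  unfold firstPortal
  rw [this, Int.ceil_intCast, ← this, div_mul_cancel₀ _ (spacing_pos m H).ne']

/-- The block of height `h` that contains `v` also contains a portal. -/
def HasPortal (m H h : ℕ) (v : ℤ) : Prop :=
  ⌊firstPortal (spacing m H) (blockStart h v)⌋ / 2 ^ h = v / 2 ^ h

theorem hasPortal_of_le {m H h : ℕ} (hh : H ≤ h) (v : ℤ) : HasPortal m H h v := by
  rw [HasPortal, firstPortal_blockStart_of_le hh, Int.floor_intCast, blockStart_ediv]

open Classical in
/-- The height of the smallest block that contains `v` and a portal. -/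
noncomputable def portalHeight (m H : ℕ) (v : ℤ) : ℕ :=
  Nat.find (⟨H, hasPortal_of_le le_rfl v⟩ : ∃ h, HasPortal m H h v)

theorem portalHeight_le (m H : ℕ) (v : ℤ) : portalHeight m H v ≤ H := by
  classical
  exact Nat.find_min' _ (hasPortal_of_le le_rfl v)

/-- The portal to which a crossing at `v` is moved. -/
noncomputable def portalOf (m H : ℕ) (v : ℤ) : ℝ :=
  firstPortal (spacing m H) (blockStart (portalHeight m H v) v)

theorem floor_portalOf (m H : ℕ) (v : ℤ) :
    ⌊portalOf m H v⌋ / 2 ^ portalHeight m H v = v / 2 ^ portalHeight m H v := by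
  classical
  exact Nat.find_spec (⟨H, hasPortal_of_le le_rfl v⟩ : ∃ h, HasPortal m H h v)

theorem exists_portalOf_eq (m H : ℕ) (v : ℤ) : ∃ t : ℤ, portalOf m H v = t * spacing m H :=
  ⟨_, rfl⟩

/-- The portal lies less than one spacing above the start of the block, and this start is an
integer. -/
theorem fract_portalOf_le (m H : ℕ) (v : ℤ) : Int.fract (portalOf m H v) ≤ spacing m H := by
  have h1 := le_firstPortal (spacing_pos m H) (blockStart (portalHeight m H v) v)
  have h2 := firstPortal_lt (spacing_pos m H) (blockStart (portalHeight m H v) v)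
  have h3 : blockStart (portalHeight m H v) v ≤ ⌊portalOf m H v⌋ := Int.le_floor.2 h1
  have h4 : ((blockStart (portalHeight m H v) v : ℤ) : ℝ) ≤ ⌊portalOf m H v⌋ := by exact_mod_cast h3
  have h5 := Int.floor_add_fract (portalOf m H v)
  change portalOf m H v < _ at h2
  linarith

/-- By minimality, the block of half the size around `v` contains no portal, so its length is at
most the spacing. -/
theorem portalHeight_cost (m H : ℕ) (v : ℤ) :
    ((2 ^ portalHeight m H v - 1 : ℕ) : ℝ) ≤ 2 * spacing m H := by
  classical
  rcases Nat.eq_zero_or_eq_succ_pred (portalHeight m H v) with h0 | h0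
  · rw [h0]; simp [(spacing_pos m H).le]
  · set g := (portalHeight m H v).pred
    have hlt : g < portalHeight m H v := by omega
    have hn : ¬ HasPortal m H g v := Nat.find_min _ hlt
    have h1 := le_firstPortal (spacing_pos m H) (blockStart g v)
    have h2 := firstPortal_lt (spacing_pos m H) (blockStart g v)
    have h3 : ((blockStart g v : ℤ) : ℝ) + 2 ^ g ≤ firstPortal (spacing m H) (blockStart g v) := by
      by_contra hlt
      push Not at hlt
      apply hn
      rw [HasPortal, ediv_pow_eq_iff]
      refine ⟨Int.le_floor.2 h1, Int.floor_lt.2 (lt_of_lt_of_eq hlt ?_)⟩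
      unfold blockStart
      push_cast
      ring
    have h4 : (2 : ℝ) ^ g ≤ spacing m H := by linarith
    rw [h0, Nat.cast_sub Nat.one_le_two_pow]
    push_cast
    rw [Nat.succ_eq_add_one, pow_succ]
    linarith

/-- Blocks are nested or disjoint. If the largest block used by a point whose portal falls into
block `q` has height `G`, or if `G = h` is larger, then all such points lie in one block of height
`G`, which has at most `r` points of `A`. -/
theorem portalOf_count {m H r : ℕ} {A : Finset ℤ}
    (hA : ∀ h ≤ H, ∀ q, (inBlock A h q).card ≤ r) {h : ℕ} (hh : h ≤ H) (q : ℤ) :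
    ((A.image (portalOf m H)).filter fun x => ⌊x⌋ / 2 ^ h = q).card ≤ r := by
  classical
  rw [Finset.filter_image]
  refine Finset.card_image_le.trans ?_
  set B := A.filter fun v => ⌊portalOf m H v⌋ / 2 ^ h = q with hB
  rcases B.eq_empty_or_nonempty with he | hne
  · simp [he]
  · obtain ⟨v₀, hv₀, hmax⟩ := B.exists_max_image (portalHeight m H) hne
    set G := max h (portalHeight m H v₀) with hG
    refine le_trans (Finset.card_le_card fun v hv => ?_)
      (hA G (max_le hh (portalHeight_le m H v₀)) (v₀ / 2 ^ G))
    refine Finset.mem_filter.2 ⟨(Finset.mem_filter.1 hv).1, ?_⟩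
    have h1 := ediv_pow_mono ((hmax v hv).trans (le_max_right _ _) : _ ≤ G) (floor_portalOf m H v)
    have h2 := ediv_pow_mono (le_max_right _ _ : _ ≤ G) (floor_portalOf m H v₀)
    have h3 := ediv_pow_mono (le_max_left _ _ : _ ≤ G)
      ((Finset.mem_filter.1 hv).2.trans (Finset.mem_filter.1 hv₀).2.symm)
    exact h1.symm.trans (h3.trans h2)

/-- The portals at which a line of height `H` with crossing requests `R` is crossed. -/
noncomputable def crossings (r m H : ℕ) (R : Finset ℤ) : Finset ℝ :=
  (reps r R H).image (portalOf m H)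

/-- The unit steps that are run on both sides of a line of height `H` with crossing
requests `R`. -/
noncomputable def strand (r m H : ℕ) (R : Finset ℤ) : Finset ℤ :=
  ((Finset.range H).biUnion fun h => (heavyBlocks r R h).biUnion (blockSteps (h + 1))) ∪
    (reps r R H).biUnion fun v => blockSteps (portalHeight m H v) (v / 2 ^ portalHeight m H v)

theorem crossings_count {r : ℕ} (hr : 0 < r) (m H : ℕ) (R : Finset ℤ) {h : ℕ} (hh : h ≤ H) (q : ℤ) :
    ((crossings r m H R).filter fun x => ⌊x⌋ / 2 ^ h = q).card ≤ r :=
  portalOf_count (fun _ hg q => inBlock_reps_card_le hr R hg q) hh q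

theorem mem_crossings {r m H : ℕ} {R : Finset ℤ} {x : ℝ} (hx : x ∈ crossings r m H R) :
    (∃ t : ℤ, x = t * spacing m H) ∧ ∃ v ∈ R, ∃ h ≤ H, ⌊x⌋ / 2 ^ h = v / 2 ^ h := by
  obtain ⟨v, hv, rfl⟩ := Finset.mem_image.1 hx
  exact ⟨exists_portalOf_eq m H v, v, reps_subset r R H hv, _, portalHeight_le m H v,
    floor_portalOf m H v⟩

theorem mem_strand {r m H : ℕ} {R : Finset ℤ} {z : ℤ} (hz : z ∈ strand r m H R) :
    ∃ v ∈ R, ∃ h ≤ H, z / 2 ^ h = v / 2 ^ h ∧ (z + 1) / 2 ^ h = v / 2 ^ h := by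
  simp only [strand, Finset.mem_union, Finset.mem_biUnion, Finset.mem_range] at hz
  rcases hz with ⟨h, hh, q, hq, hz⟩ | ⟨v, hv, hz⟩
  · obtain ⟨v, hv, rfl⟩ := Finset.mem_image.1 (Finset.mem_filter.1 hq).1
    exact ⟨v, reps_subset r R h hv, h + 1, hh, mem_blockSteps.1 hz⟩
  · exact ⟨v, reps_subset r R H hv, _, portalHeight_le m H v, mem_blockSteps.1 hz⟩

/-- The relation `s` stands for connectivity along the strand. Each thinning moves a request within
a heavy block, and the last move stays within the block shared with the portal. An arbitrary `s`
allows both sides of the line to be treated at once. -/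
theorem exists_crossing (r m H : ℕ) (R : Finset ℤ) (s : Setoid ℤ)
    (hs : ∀ z ∈ strand r m H R, s z (z + 1)) {y : ℤ} (hy : y ∈ R) :
    ∃ x ∈ crossings r m H R, s y ⌊x⌋ := by
  have hrep : ∀ h ≤ H, ∃ v ∈ reps r R h, s y v := by
    intro h
    induction h with
    | zero => exact fun _ => ⟨y, hy, s.refl y⟩
    | succ h ih =>
      intro hh
      obtain ⟨v, hv, hyv⟩ := ih (by omega)
      obtain ⟨w, hw, hvw⟩ := exists_mem_thin (r := r) (h := h + 1) hv
      refine ⟨w, hw, s.trans hyv ?_⟩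
      rcases hvw with rfl | ⟨hb, hq⟩
      · exact s.refl _
      · refine setoid_of_blockSteps s hb fun z hz => hs z (Finset.mem_union_left _ ?_)
        exact Finset.mem_biUnion.2 ⟨h, Finset.mem_range.2 hh, Finset.mem_biUnion.2 ⟨_, hq, hz⟩⟩
  obtain ⟨v, hv, hyv⟩ := hrep H le_rfl
  refine ⟨portalOf m H v, Finset.mem_image_of_mem _ hv, s.trans hyv ?_⟩
  refine setoid_of_blockSteps s (floor_portalOf m H v) fun z hz => hs z
    (Finset.mem_union_right _ (Finset.mem_biUnion.2 ⟨v, hv, hz⟩))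

/-- The factor 3 is two spacings for the portal block and one for the fractional part. On a line of
height 0 all integers are portals, so moving is free. This lets a height `H > 0` be charged to the
index `H - 1` later. -/
theorem strand_cost (r : ℕ) {m : ℕ} (hm : 0 < m) (H : ℕ) (R : Finset ℤ) :
    ((strand r m H R).card : ℝ) + ∑ x ∈ crossings r m H R, Int.fract x ≤
      (∑ h ∈ Finset.range H, (heavyBlocks r R h).card * 2 ^ (h + 1) : ℝ) +
        if H = 0 then 0 else 3 * (R.card : ℝ) * 2 ^ H / m := by
  have h1 : (strand r m H R).card ≤
      ∑ h ∈ Finset.range H, (heavyBlocks r R h).card * 2 ^ (h + 1) +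
      ∑ v ∈ reps r R H, (2 ^ portalHeight m H v - 1) := by
    refine (Finset.card_union_le _ _).trans (add_le_add ?_ ?_)
    · refine Finset.card_biUnion_le.trans (Finset.sum_le_sum fun h _ => ?_)
      refine Finset.card_biUnion_le.trans ?_
      simp only [card_blockSteps, Finset.sum_const, smul_eq_mul]
      gcongr
      exact Nat.sub_le _ _
    · refine Finset.card_biUnion_le.trans (Finset.sum_le_sum fun v _ => ?_)
      rw [card_blockSteps]
  have h2 : ∑ x ∈ crossings r m H R, Int.fract x ≤
      ∑ v ∈ reps r R H, Int.fract (portalOf m H v) :=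
    Finset.sum_image_le_of_nonneg fun _ _ => Int.fract_nonneg _
  have h3 : ∑ v ∈ reps r R H, (((2 ^ portalHeight m H v - 1 : ℕ) : ℝ) +
      Int.fract (portalOf m H v)) ≤ if H = 0 then 0 else 3 * (R.card : ℝ) * 2 ^ H / m := by
    split_ifs with hH
    · subst hH
      refine Finset.sum_nonpos fun v _ => ?_
      have hg : portalHeight m 0 v = 0 := Nat.le_zero.1 (portalHeight_le m 0 v)
      rw [portalOf, firstPortal_blockStart_of_le (Nat.zero_le _), hg]
      simp
    · have hb : ∀ v ∈ reps r R H, ((2 ^ portalHeight m H v - 1 : ℕ) : ℝ) +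
          Int.fract (portalOf m H v) ≤ 3 * 2 ^ H / m := by
        intro v _
        have h4 := portalHeight_cost m H v
        have h5 := fract_portalOf_le m H v
        have h6 : spacing m H ≤ 2 ^ H / m := by
          unfold spacing
          have : (0 : ℝ) < m := by exact_mod_cast hm
          exact div_le_div_of_nonneg_left (by positivity) this (by linarith)
        rw [mul_div_assoc]
        linarith
      refine (Finset.sum_le_card_nsmul _ _ _ hb).trans ?_
      have h7 : ((reps r R H).card : ℝ) ≤ R.card := by
        exact_mod_cast Finset.card_le_card (reps_subset r R H)
      rw [nsmul_eq_mul]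
      exact (mul_le_mul_of_nonneg_right h7 (by positivity)).trans_eq (by ring)
  rw [Finset.sum_add_distrib] at h3
  have h4 : ((strand r m H R).card : ℝ) ≤
      (∑ h ∈ Finset.range H, (heavyBlocks r R h).card * 2 ^ (h + 1) : ℝ) +
      ∑ v ∈ reps r R H, ((2 ^ portalHeight m H v - 1 : ℕ) : ℝ) := by exact_mod_cast h1
  linarith

/-! ### The graph with detours on unit cells -/

/-- The exponent of the largest power of two, at most `2 ^ k`, that divides `n`. -/
def lineHeight (k : ℕ) (n : ℤ) : ℕ := Nat.findGreatest (fun h => (2 : ℤ) ^ h ∣ n) k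

theorem lineHeight_le (k : ℕ) (n : ℤ) : lineHeight k n ≤ k := Nat.findGreatest_le k

theorem pow_lineHeight_dvd (k : ℕ) (n : ℤ) : (2 : ℤ) ^ lineHeight k n ∣ n :=
  Nat.findGreatest_spec (P := fun h => (2 : ℤ) ^ h ∣ n) (Nat.zero_le k) (by simp)

theorem le_lineHeight {k h : ℕ} {n : ℤ} (hk : h ≤ k) (hn : (2 : ℤ) ^ h ∣ n) : h ≤ lineHeight k n :=
  Nat.le_findGreatest hk hn

/-- A vertex of the constructed tree: a point together with the unit cell to which it belongs. -/
abbrev Node : Type := (ℤ × ℤ) × (ℝ × ℝ)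

/-- The lattice point `p` as a corner of the unit cell above and to the right of it. -/
def cornerNode (p : ℤ × ℤ) : Node := (p, ((p.1 : ℝ), (p.2 : ℝ)))

/-- The reflection of a node in the diagonal. -/
def swapNode (w : Node) : Node := (w.1.swap, w.2.swap)

/-- A unit step along the line `x = n` inside the cells of column `c`. -/
noncomputable def strandEdges (c n z : ℤ) : Finset (Node × Node) :=
  {(((c, z), ((n : ℝ), (z : ℝ))), ((c, z), ((n : ℝ), (z : ℝ) + 1))),
    (((c, z), ((n : ℝ), (z : ℝ) + 1)), ((c, z + 1), ((n : ℝ), (z : ℝ) + 1)))}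

/-- The edges that cross the line `x = n` at height `x` and lead there along the line. -/
noncomputable def crossEdges (n : ℤ) (x : ℝ) : Finset (Node × Node) :=
  {(((n - 1, ⌊x⌋), ((n : ℝ), (⌊x⌋ : ℝ))), ((n - 1, ⌊x⌋), ((n : ℝ), x))),
    (((n, ⌊x⌋), ((n : ℝ), (⌊x⌋ : ℝ))), ((n, ⌊x⌋), ((n : ℝ), x))),
    (((n - 1, ⌊x⌋), ((n : ℝ), x)), ((n, ⌊x⌋), ((n : ℝ), x)))}

/-- The heights at which the horizontal unit edges in `H` reach the line `x = n` from the left. -/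
def rows (H : Finset (ℤ × ℤ)) (n : ℤ) : Finset ℤ :=
  (H.filter fun p => p.1 + 1 = n).image Prod.snd

/-- The portals at which the line `x = n` is crossed. -/
noncomputable def lineCrossings (k r m : ℕ) (H : Finset (ℤ × ℤ)) (n : ℤ) : Finset ℝ :=
  crossings r m (lineHeight k n) (rows H n)

/-- The unit steps taken along the line `x = n`. -/
noncomputable def lineStrand (k r m : ℕ) (H : Finset (ℤ × ℤ)) (n : ℤ) : Finset ℤ :=
  strand r m (lineHeight k n) (rows H n)

/-- The lines that are reached from the left by horizontal edges. -/
def linesOf (H : Finset (ℤ × ℤ)) : Finset ℤ := H.image fun p => p.1 + 1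

/-- The edges added along the line `x = n`. -/
noncomputable def lineEdges (k r m : ℕ) (H : Finset (ℤ × ℤ)) (n : ℤ) : Finset (Node × Node) :=
  (lineStrand k r m H n).biUnion (fun z => strandEdges (n - 1) n z ∪ strandEdges n n z) ∪
    (lineCrossings k r m H n).biUnion (crossEdges n)

/-- The horizontal unit edges in `H` with the detours needed to cross vertical lines. -/
noncomputable def horizontalEdges (k r m : ℕ) (H : Finset (ℤ × ℤ)) : Finset (Node × Node) :=
  H.image (fun p => (cornerNode p, ((p, ((p.1 : ℝ) + 1, (p.2 : ℝ))) : Node))) ∪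
    (linesOf H).biUnion (lineEdges k r m H)

/-- The edges of the light graph obtained from horizontal edges `H` and vertical edges `K`. -/
noncomputable def lightEdges (k r m : ℕ) (H K : Finset (ℤ × ℤ)) : Finset (Node × Node) :=
  horizontalEdges k r m H ∪
    (horizontalEdges k r m (K.image Prod.swap)).image (Prod.map swapNode swapNode)

theorem mem_rows {H : Finset (ℤ × ℤ)} {n y : ℤ} : y ∈ rows H n ↔ (n - 1, y) ∈ H := by
  simp only [rows, Finset.mem_image, Finset.mem_filter, Prod.exists, exists_eq_right]
  constructor
  · rintro ⟨a, h, rfl⟩; simpa using h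
  · exact fun h => ⟨n - 1, h, by ring⟩

/-! ### Connectivity -/

theorem reachable_map {M N : Type*} {E : Finset (M × M)} {F : Finset (N × N)} (f : M → N)
    (h : ∀ e ∈ E, (f e.1, f e.2) ∈ F) {u v : M} (huv : (pairGraph E).Reachable u v) :
    (pairGraph F).Reachable (f u) (f v) := by
  obtain ⟨p⟩ := huv
  induction p with
  | nil => rfl
  | cons hadj _ ih =>
    simp only [pairGraph, SimpleGraph.fromRel_adj] at hadj
    refine SimpleGraph.Reachable.trans ?_ ih
    rcases hadj.2 with h1 | h1
    · exact reachable_of_mem (h _ h1)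
    · exact (reachable_of_mem (h _ h1)).symm

theorem reachable_horizontalEdges (k r m : ℕ) (H : Finset (ℤ × ℤ)) {p : ℤ × ℤ} (hp : p ∈ H) :
    (pairGraph (horizontalEdges k r m H)).Reachable (cornerNode p) (cornerNode (p.1 + 1, p.2)) := by
  set G := pairGraph (horizontalEdges k r m H) with hG
  obtain ⟨a, y⟩ := p
  obtain ⟨n, rfl⟩ : ∃ n, a = n - 1 := ⟨a + 1, by ring⟩
  have hn : n ∈ linesOf H := Finset.mem_image.2 ⟨_, hp, by ring⟩
  have hline : ∀ e ∈ lineEdges k r m H n, e ∈ horizontalEdges k r m H := fun e he =>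
    Finset.mem_union_right _ (Finset.mem_biUnion.2 ⟨n, hn, he⟩)
  let node : ℤ → ℤ → Node := fun c z => ((c, z), ((n : ℝ), (z : ℝ)))
  have hstrand : ∀ c, c = n - 1 ∨ c = n → ∀ z ∈ lineStrand k r m H n,
      G.Reachable (node c z) (node c (z + 1)) := by
    intro c hc z hz
    have hsub : ∀ e ∈ strandEdges c n z, e ∈ horizontalEdges k r m H := by
      refine fun e he => hline e (Finset.mem_union_left _ (Finset.mem_biUnion.2 ⟨z, hz, ?_⟩))
      rcases hc with rfl | rfl
      · exact Finset.mem_union_left _ he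
      · exact Finset.mem_union_right _ he
    have h1 : G.Reachable (node c z) ((c, z), (n, z + 1)) :=
      reachable_of_mem (hsub _ (by simp [strandEdges, node]))
    have h2 : G.Reachable ((c, z), ((n : ℝ), (z : ℝ) + 1)) (node c (z + 1)) :=
      reachable_of_mem (hsub _ (by simp [strandEdges, node]))
    exact h1.trans h2
  -- Two rows are related if the strands join them on both sides of the line, so the way to the
  -- crossing and the way back are found together.
  let s : Setoid ℤ :=
    { r := fun y z => G.Reachable (node (n - 1) y) (node (n - 1) z) ∧
        G.Reachable (node n y) (node n z)
      iseqv := ⟨fun _ => ⟨SimpleGraph.Reachable.refl _, SimpleGraph.Reachable.refl _⟩,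
        fun h => ⟨h.1.symm, h.2.symm⟩,
        fun h1 h2 => ⟨h1.1.trans h2.1, h1.2.trans h2.2⟩⟩ }
  obtain ⟨x, hx, h1, h2⟩ := exists_crossing r m (lineHeight k n) (rows H n) s
    (fun z hz => ⟨hstrand _ (Or.inl rfl) z hz, hstrand _ (Or.inr rfl) z hz⟩) (mem_rows.2 hp)
  have hcross : ∀ e ∈ crossEdges n x, e ∈ horizontalEdges k r m H := fun e he =>
    hline e (Finset.mem_union_right _ (Finset.mem_biUnion.2 ⟨x, hx, he⟩))
  have h3 : G.Reachable (node (n - 1) ⌊x⌋) ((n - 1, ⌊x⌋), (n, x)) :=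
    reachable_of_mem (hcross _ (by simp [crossEdges, node]))
  have h4 : G.Reachable (node n ⌊x⌋) ((n, ⌊x⌋), (n, x)) :=
    reachable_of_mem (hcross _ (by simp [crossEdges, node]))
  have h5 : G.Reachable ((n - 1, ⌊x⌋), ((n : ℝ), x)) ((n, ⌊x⌋), (n, x)) :=
    reachable_of_mem (hcross _ (by simp [crossEdges]))
  have h6 : G.Reachable (cornerNode (n - 1, y)) (node (n - 1) y) := by
    refine reachable_of_mem (Finset.mem_union_left _ (Finset.mem_image.2 ⟨_, hp, ?_⟩))
    simp [node]
  have h7 : cornerNode ((n - 1, y).1 + 1, (n - 1, y).2) = node n y := by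
    simp [cornerNode, node]
  rw [h7]
  exact h6.trans (h1.trans (h3.trans (h5.trans (h4.symm.trans h2.symm))))

theorem reachable_lightEdges (k r m : ℕ) (H K V : Finset (ℤ × ℤ)) (hc : Connects H K V)
    {p q : ℤ × ℤ} (hp : p ∈ V) (hq : q ∈ V) :
    (pairGraph (lightEdges k r m H K)).Reachable (cornerNode p) (cornerNode q) := by
  set G := pairGraph (lightEdges k r m H K) with hG
  let s : Setoid (ℤ × ℤ) :=
    { r := fun p q => G.Reachable (cornerNode p) (cornerNode q)
      iseqv := ⟨fun _ => SimpleGraph.Reachable.refl _, fun h => h.symm, fun h1 h2 => h1.trans h2⟩ }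
  refine hc s (fun p hp => ?_) (fun p hp => ?_) p hp q hq
  · exact reachable_map id (fun e he => Finset.mem_union_left _ he)
      (reachable_horizontalEdges k r m H hp)
  · exact reachable_map swapNode (fun e he => Finset.mem_union_right _
      (Finset.mem_image_of_mem (Prod.map swapNode swapNode) he))
      (reachable_horizontalEdges k r m (K.image Prod.swap) (Finset.mem_image_of_mem Prod.swap hp))

/-! ### Length -/

/-- The length added along the line `x = n`. -/
noncomputable def lineCost (k r m : ℕ) (H : Finset (ℤ × ℤ)) (n : ℤ) : ℝ :=
  2 * ((lineStrand k r m H n).card + ∑ x ∈ lineCrossings k r m H n, Int.fract x)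

/-- Only the first edge has length. The second stays at one point and changes the unit cell. -/
theorem pairLength_strandEdges_le (c n z : ℤ) : pairLength Prod.snd (strandEdges c n z) ≤ 1 := by
  unfold strandEdges
  refine (pairLength_insert_le _ _ _).trans ?_
  simp [pairLength, l1dist]

theorem pairLength_crossEdges_le (n : ℤ) (x : ℝ) :
    pairLength Prod.snd (crossEdges n x) ≤ 2 * Int.fract x := by
  unfold crossEdges
  refine (pairLength_insert_le _ _ _).trans ?_
  refine (add_le_add_right (pairLength_insert_le _ _ _) _).trans (le_of_eq ?_)
  have h : |(⌊x⌋ : ℝ) - x| = Int.fract x := by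
    rw [abs_sub_comm, Int.self_sub_floor, abs_of_nonneg (Int.fract_nonneg x)]
  simp [pairLength, l1dist, h]
  ring

theorem pairLength_lineEdges_le (k r m : ℕ) (H : Finset (ℤ × ℤ)) (n : ℤ) :
    pairLength Prod.snd (lineEdges k r m H n) ≤ lineCost k r m H n := by
  refine (pairLength_union_le _ _ _).trans ?_
  rw [lineCost, mul_add, Finset.mul_sum]
  refine add_le_add ((pairLength_biUnion_le _ _ _).trans ?_)
    ((pairLength_biUnion_le _ _ _).trans (Finset.sum_le_sum fun x _ => pairLength_crossEdges_le n x))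
  refine (Finset.sum_le_card_nsmul _ _ 2 fun z _ => ?_).trans (by rw [nsmul_eq_mul, mul_comm])
  refine (pairLength_union_le _ _ _).trans ?_
  linarith [pairLength_strandEdges_le (n - 1) n z, pairLength_strandEdges_le n n z]

theorem pairLength_horizontalEdges_le (k r m : ℕ) (H : Finset (ℤ × ℤ)) :
    pairLength Prod.snd (horizontalEdges k r m H) ≤
      H.card + ∑ n ∈ linesOf H, lineCost k r m H n := by
  refine (pairLength_union_le _ _ _).trans (add_le_add ?_ ((pairLength_biUnion_le _ _ _).trans
    (Finset.sum_le_sum fun n _ => pairLength_lineEdges_le k r m H n)))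
  refine (Finset.sum_image_le_of_nonneg fun _ _ => l1dist_nonneg _ _).trans ?_
  simp [l1dist, cornerNode]

theorem pairLength_lightEdges_le (k r m : ℕ) (H K : Finset (ℤ × ℤ)) :
    pairLength Prod.snd (lightEdges k r m H K) ≤
      (H.card + K.card : ℕ) + (∑ n ∈ linesOf H, lineCost k r m H n +
        ∑ n ∈ linesOf (K.image Prod.swap), lineCost k r m (K.image Prod.swap) n) := by
  have h1 := pairLength_horizontalEdges_le k r m H
  have h2 := pairLength_horizontalEdges_le k r m (K.image Prod.swap)
  have h3 : pairLength Prod.snd ((horizontalEdges k r m (K.image Prod.swap)).image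
      (Prod.map swapNode swapNode)) ≤
        pairLength Prod.snd (horizontalEdges k r m (K.image Prod.swap)) := by
    refine (Finset.sum_image_le_of_nonneg fun _ _ => l1dist_nonneg _ _).trans (le_of_eq ?_)
    exact Finset.sum_congr rfl fun e _ => add_comm _ _
  rw [Finset.card_image_of_injective _ Prod.swap_injective] at h2
  refine (pairLength_union_le _ _ _).trans ?_
  push_cast
  linarith

/-! ### Cells and crossings -/

/-- The point `p` lies in the closed unit cell `c`. -/
def InUnitCell (c : ℤ × ℤ) (p : ℝ × ℝ) : Prop :=
  ((c.1 : ℝ) ≤ p.1 ∧ p.1 ≤ c.1 + 1) ∧ ((c.2 : ℝ) ≤ p.2 ∧ p.2 ≤ c.2 + 1)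

/-- The unit cell `c` lies in the root cell. -/
def InRoot (k : ℕ) (c : ℤ × ℤ) : Prop :=
  (0 ≤ c.1 ∧ c.1 < 2 ^ (k + 1)) ∧ (0 ≤ c.2 ∧ c.2 < 2 ^ (k + 1))

/-- The node `w` is a place where the line on the left of its cell may be crossed: one of the
chosen portals, or a point where a line of at least the same height meets it. -/
def MayCross (k r m : ℕ) (H : Finset (ℤ × ℤ)) (w : Node) : Prop :=
  (∃ x ∈ lineCrossings k r m H w.1.1, w = ((w.1.1, ⌊x⌋), ((w.1.1 : ℝ), x))) ∨
    ∃ y : ℤ, w.2.2 = y ∧ (2 : ℤ) ^ lineHeight k w.1.1 ∣ y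

/-- The possible positions of an edge from `u` to `v` relative to the unit cells. -/
def EdgeSpec (k r m : ℕ) (H K : Finset (ℤ × ℤ)) (e : Node × Node) : Prop :=
  (e.1.2.1 = e.2.2.1 ∨ e.1.2.2 = e.2.2.2) ∧
  InUnitCell e.1.1 e.1.2 ∧ InUnitCell e.1.1 e.2.2 ∧ InRoot k e.1.1 ∧
  (e.2.1 = e.1.1 ∨ (e.2.1 = (e.1.1.1 + 1, e.1.1.2) ∧ MayCross k r m H e.2) ∨
    (e.2.1 = (e.1.1.1, e.1.1.2 + 1) ∧ MayCross k r m (K.image Prod.swap) (swapNode e.2)))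

theorem EdgeSpec.swap {k r m : ℕ} {H K : Finset (ℤ × ℤ)} {e : Node × Node}
    (h : EdgeSpec k r m (K.image Prod.swap) (H.image Prod.swap) e) :
    EdgeSpec k r m H K (swapNode e.1, swapNode e.2) := by
  obtain ⟨h1, ⟨h2, h3⟩, ⟨h4, h5⟩, ⟨h6, h7⟩, h8⟩ := h
  refine ⟨h1.symm, ⟨h3, h2⟩, ⟨h5, h4⟩, ⟨h7, h6⟩, ?_⟩
  have hH : (H.image Prod.swap).image Prod.swap = H := by
    rw [Finset.image_image]; simp
  rw [hH] at h8
  rcases h8 with h | ⟨h, h'⟩ | ⟨h, h'⟩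
  · exact Or.inl (by simp [swapNode, h])
  · exact Or.inr (Or.inr ⟨by simp [swapNode, h], h'⟩)
  · exact Or.inr (Or.inl ⟨by simp [swapNode, h], h'⟩)

/-- Blocks of height at most `k` refine the block `[0, 2 ^ (k + 1))`, so detours never leave the
root cell. -/
theorem block_mem_root {k h : ℕ} (hk : h ≤ k) {z v : ℤ} (hzv : z / 2 ^ h = v / 2 ^ h)
    (hv : 0 ≤ v ∧ v < 2 ^ (k + 1)) : 0 ≤ z ∧ z < 2 ^ (k + 1) := by
  have h1 := ediv_pow_mono (Nat.le_succ_of_le hk) hzv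
  have h2 : v / 2 ^ (k + 1) = 0 := ediv_pow_eq_iff.2 (by simpa using hv)
  simpa using ediv_pow_eq_iff.1 (h1.trans h2)

theorem edgeSpec_horizontalEdges {k r m : ℕ} {H K : Finset (ℤ × ℤ)}
    (hH : ∀ p ∈ H, 0 ≤ p.1 ∧ p.1 + 1 < 2 ^ (k + 1) ∧ 0 ≤ p.2 ∧ p.2 < 2 ^ (k + 1))
    {e : Node × Node} (he : e ∈ horizontalEdges k r m H) : EdgeSpec k r m H K e := by
  simp only [horizontalEdges, Finset.mem_union, Finset.mem_image, Finset.mem_biUnion] at he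
  rcases he with ⟨p, hp, rfl⟩ | ⟨n, hn, he⟩
  · obtain ⟨h1, h2, h3, h4⟩ := hH p hp
    refine ⟨Or.inr rfl, ?_, ?_, ⟨⟨h1, by simp [cornerNode]; omega⟩, ⟨h3, h4⟩⟩, Or.inl rfl⟩ <;>
      simp [InUnitCell, cornerNode]
  · obtain ⟨q, hq, rfl⟩ := Finset.mem_image.1 hn
    obtain ⟨hq1, hq2, -, -⟩ := hH q hq
    set n := q.1 + 1 with hn
    have hrow : ∀ v ∈ rows H n, 0 ≤ v ∧ v < 2 ^ (k + 1) := fun v hv =>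
      (hH _ (mem_rows.1 hv)).2.2
    simp only [lineEdges, Finset.mem_union, Finset.mem_biUnion] at he
    rcases he with ⟨z, hz, he⟩ | ⟨x, hx, he⟩
    · obtain ⟨v, hv, h, hh, hz1, hz2⟩ := mem_strand hz
      have hk := hh.trans (lineHeight_le k n)
      have hb1 := block_mem_root hk hz1 (hrow v hv)
      -- `z` and `z + 1` share a block of height `h`, which is at most the height of `n`. Hence the
      -- horizontal line at `z + 1` has height below `h`.
      have hmay : (2 : ℤ) ^ lineHeight k (z + 1) ∣ n := by
        refine (pow_dvd_pow 2 ?_).trans (pow_lineHeight_dvd k n)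
        by_contra hlt
        push Not at hlt
        exact not_dvd_of_ediv_eq (hz1.trans hz2.symm)
          ((pow_dvd_pow 2 (hh.trans hlt.le)).trans (pow_lineHeight_dvd k (z + 1)))
      have key : ∀ c, c = n - 1 ∨ c = n → e ∈ strandEdges c n z → EdgeSpec k r m H K e := by
        intro c hc he
        have hcn : (c : ℝ) ≤ n ∧ (n : ℝ) ≤ c + 1 := by
          constructor <;> norm_cast <;> omega
        have hcr : 0 ≤ c ∧ c < 2 ^ (k + 1) := by omega
        simp only [strandEdges, Finset.mem_insert, Finset.mem_singleton] at he
        rcases he with rfl | rfl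
        · refine ⟨Or.inl rfl, ⟨hcn, ?_⟩, ⟨hcn, ?_⟩, ⟨hcr, hb1⟩, Or.inl rfl⟩ <;> simp
        · refine ⟨Or.inl rfl, ⟨hcn, ?_⟩, ⟨hcn, ?_⟩, ⟨hcr, hb1⟩, Or.inr (Or.inr ⟨rfl, ?_⟩)⟩
          · simp
          · simp
          · exact Or.inr ⟨n, rfl, hmay⟩
      rcases he with he | he
      · exact key _ (Or.inl rfl) he
      · exact key _ (Or.inr rfl) he
    · obtain ⟨-, v, hv, h, hh, hx1⟩ := mem_crossings hx
      have hk := hh.trans (lineHeight_le k n)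
      have hb := block_mem_root hk hx1 (hrow v hv)
      have hfl : (⌊x⌋ : ℝ) ≤ x ∧ x ≤ ⌊x⌋ + 1 := ⟨Int.floor_le x, (Int.lt_floor_add_one x).le⟩
      simp only [crossEdges, Finset.mem_insert, Finset.mem_singleton] at he
      rcases he with rfl | rfl | rfl
      · refine ⟨Or.inl rfl, ⟨?_, ?_⟩, ⟨?_, hfl⟩, ⟨⟨by simp; omega, by simp; omega⟩, hb⟩, Or.inl rfl⟩ <;>
          simp
      · refine ⟨Or.inl rfl, ⟨?_, ?_⟩, ⟨?_, hfl⟩, ⟨⟨by simp; omega, by simp; omega⟩, hb⟩, Or.inl rfl⟩ <;>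
          simp
      · refine ⟨Or.inl rfl, ⟨?_, hfl⟩, ⟨?_, hfl⟩, ⟨⟨by simp; omega, by simp; omega⟩, hb⟩,
          Or.inr (Or.inl ⟨?_, Or.inl ⟨x, hx, rfl⟩⟩)⟩ <;> simp

theorem edgeSpec_lightEdges {k r m : ℕ} {H K : Finset (ℤ × ℤ)}
    (hH : ∀ p ∈ H, 0 ≤ p.1 ∧ p.1 + 1 < 2 ^ (k + 1) ∧ 0 ≤ p.2 ∧ p.2 < 2 ^ (k + 1))
    (hK : ∀ p ∈ K, 0 ≤ p.1 ∧ p.1 < 2 ^ (k + 1) ∧ 0 ≤ p.2 ∧ p.2 + 1 < 2 ^ (k + 1))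
    {e : Node × Node} (he : e ∈ lightEdges k r m H K) : EdgeSpec k r m H K e := by
  rcases Finset.mem_union.1 he with he | he
  · exact edgeSpec_horizontalEdges hH he
  · obtain ⟨f, hf, rfl⟩ := Finset.mem_image.1 he
    refine (edgeSpec_horizontalEdges (K := H.image Prod.swap) (fun p hp => ?_) hf).swap
    obtain ⟨q, hq, rfl⟩ := Finset.mem_image.1 hp
    obtain ⟨h1, h2, h3, h4⟩ := hK q hq
    exact ⟨h3, h4, h1, h2⟩

/-- The unit cell of an edge: the lower left one of the cells of its two ends. -/
def unitCell : Sym2 Node → ℤ × ℤ :=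
  Sym2.lift ⟨fun u v => (min u.1.1 v.1.1, min u.1.2 v.1.2), fun u v => by
    simp only [min_comm]⟩

theorem unitCell_mk (u v : Node) : unitCell s(u, v) = (min u.1.1 v.1.1, min u.1.2 v.1.2) := rfl

theorem EdgeSpec.unitCell_eq {k r m : ℕ} {H K : Finset (ℤ × ℤ)} {e : Node × Node}
    (h : EdgeSpec k r m H K e) : unitCell s(e.1, e.2) = e.1.1 := by
  rw [unitCell_mk]
  rcases h.2.2.2.2 with h | ⟨h, -⟩ | ⟨h, -⟩ <;> rw [h] <;> simp

/-- The edges at a node lie in its own cell or in the cells on the left or below. -/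
theorem unitCell_of_adj {k r m : ℕ} {H K : Finset (ℤ × ℤ)} {E : Finset (Node × Node)}
    (hE : ∀ e ∈ E, EdgeSpec k r m H K e) {u v : Node} (h : (pairGraph E).Adj v u) :
    unitCell s(v, u) = v.1 ∨
      (unitCell s(v, u) = (v.1.1 - 1, v.1.2) ∧ MayCross k r m H v) ∨
      (unitCell s(v, u) = (v.1.1, v.1.2 - 1) ∧
        MayCross k r m (K.image Prod.swap) (swapNode v)) := by
  simp only [pairGraph, SimpleGraph.fromRel_adj] at h
  rcases h.2 with h | h
  · exact Or.inl (hE _ h).unitCell_eq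
  · rw [Sym2.eq_swap, (hE _ h).unitCell_eq]
    rcases (hE _ h).2.2.2.2 with h1 | ⟨h1, h2⟩ | ⟨h1, h2⟩
    · exact Or.inl h1.symm
    · exact Or.inr (Or.inl ⟨by simp at h1; simp [h1], h2⟩)
    · exact Or.inr (Or.inr ⟨by simp at h1; simp [h1], h2⟩)

theorem spec_of_adj {k r m : ℕ} {H K : Finset (ℤ × ℤ)} {E : Finset (Node × Node)}
    (hE : ∀ e ∈ E, EdgeSpec k r m H K e) {u v : Node} (h : (pairGraph E).Adj v u) :
    InUnitCell (unitCell s(v, u)) v.2 ∧ InUnitCell (unitCell s(v, u)) u.2 ∧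
      InRoot k (unitCell s(v, u)) := by
  simp only [pairGraph, SimpleGraph.fromRel_adj] at h
  rcases h.2 with h | h
  · rw [(hE _ h).unitCell_eq]
    exact ⟨(hE _ h).2.1, (hE _ h).2.2.1, (hE _ h).2.2.2.1⟩
  · rw [Sym2.eq_swap, (hE _ h).unitCell_eq]
    exact ⟨(hE _ h).2.2.1, (hE _ h).2.1, (hE _ h).2.2.2.1⟩

/-- An edge between two unit cells belongs to the lower left one. Thus only the right-hand end of an
edge over a vertical line has edges on both sides, and each passage yields one crossing vertex. -/
theorem mayCross_of_column_lt {k r m : ℕ} {H K : Finset (ℤ × ℤ)} {E : Finset (Node × Node)}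
    (hE : ∀ e ∈ E, EdgeSpec k r m H K e) {u v w : Node} (hu : (pairGraph E).Adj v u)
    (hw : (pairGraph E).Adj v w) {n : ℤ} (h1 : (unitCell s(v, u)).1 < n)
    (h2 : n ≤ (unitCell s(v, w)).1) : v.1.1 = n ∧ MayCross k r m H v := by
  rcases unitCell_of_adj hE hu with h3 | ⟨h3, h5⟩ | ⟨h3, -⟩ <;>
  rcases unitCell_of_adj hE hw with h4 | ⟨h4, -⟩ | ⟨h4, -⟩ <;>
  rw [h3] at h1 <;> rw [h4] at h2 <;> (try dsimp only at h1 h2) <;>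
  first | exact absurd h2 (by omega) | exact ⟨by omega, h5⟩

theorem mayCross_of_row_lt {k r m : ℕ} {H K : Finset (ℤ × ℤ)} {E : Finset (Node × Node)}
    (hE : ∀ e ∈ E, EdgeSpec k r m H K e) {u v w : Node} (hu : (pairGraph E).Adj v u)
    (hw : (pairGraph E).Adj v w) {n : ℤ} (h1 : (unitCell s(v, u)).2 < n)
    (h2 : n ≤ (unitCell s(v, w)).2) :
    v.1.2 = n ∧ MayCross k r m (K.image Prod.swap) (swapNode v) := by
  rcases unitCell_of_adj hE hu with h3 | ⟨h3, -⟩ | ⟨h3, h5⟩ <;>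
  rcases unitCell_of_adj hE hw with h4 | ⟨h4, -⟩ | ⟨h4, -⟩ <;>
  rw [h3] at h1 <;> rw [h4] at h2 <;> (try dsimp only at h1 h2) <;>
  first | exact absurd h2 (by omega) | exact ⟨by omega, h5⟩

/-- A node at which a line is crossed is located at a portal of the line. -/
theorem MayCross.exists_eq_mul {k r m : ℕ} {H : Finset (ℤ × ℤ)} {w : Node}
    (h : MayCross k r m H w) : ∃ t : ℤ, w.2.2 = t * spacing m (lineHeight k w.1.1) := by
  rcases h with ⟨x, hx, hw⟩ | ⟨y, hy, c, rfl⟩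
  · obtain ⟨t, ht⟩ := (mem_crossings hx).1
    refine ⟨t, ?_⟩
    rw [← ht, hw]
  · refine ⟨c * (m + 1), ?_⟩
    rw [hy, spacing]
    push_cast
    field_simp

/-- The number of crossings strictly inside an interval. -/
theorem mayCross_ncard_le {k r m : ℕ} (hr : 0 < r) {H : Finset (ℤ × ℤ)} {h : ℕ} {n : ℤ}
    (hh : h ≤ lineHeight k n) (q : ℤ) (S : Set Node)
    (hS : ∀ w ∈ S, w.1.1 = n ∧ MayCross k r m H w ∧
      ((q * 2 ^ h : ℤ) : ℝ) < w.2.2 ∧ w.2.2 < (((q + 1) * 2 ^ h : ℤ) : ℝ)) :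
    S.Finite ∧ S.ncard ≤ r := by
  set F := (lineCrossings k r m H n).filter fun x => ⌊x⌋ / 2 ^ h = q with hF
  have hsub : S ⊆ ↑(F.image fun x => (((n, ⌊x⌋), ((n : ℝ), x)) : Node)) := by
    intro w hw
    obtain ⟨rfl, hm, h1, h2⟩ := hS w hw
    rcases hm with ⟨x, hx, hwx⟩ | ⟨y, hy, hd⟩
    · refine Finset.mem_coe.2 (Finset.mem_image.2 ⟨x, Finset.mem_filter.2 ⟨hx, ?_⟩, hwx.symm⟩)
      rw [hwx] at h1 h2
      exact ediv_pow_eq_iff.2 ⟨Int.le_floor.2 h1.le, Int.floor_lt.2 h2⟩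
    -- The other kind of crossing lies at a multiple of `2 ^ h`, and none is strictly between two
    -- consecutive multiples.
    · rw [hy] at h1 h2
      obtain ⟨c, rfl⟩ := (pow_dvd_pow 2 hh).trans hd
      have h1' : q * 2 ^ h < 2 ^ h * c := by exact_mod_cast h1
      have h2' : 2 ^ h * c < (q + 1) * 2 ^ h := by exact_mod_cast h2
      have hp : (0 : ℤ) < 2 ^ h := by positivity
      rw [mul_comm] at h1' h2'
      have h3 := lt_of_mul_lt_mul_left h1' hp.le
      rw [mul_comm] at h2'
      have h4 : c < q + 1 := by nlinarith
      omega
  refine ⟨(Finset.finite_toSet _).subset hsub, ?_⟩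
  refine (Set.ncard_le_ncard hsub (Finset.finite_toSet _)).trans ?_
  rw [Set.ncard_coe_finset]
  exact Finset.card_image_le.trans (crossings_count hr m _ _ hh q)

/-! ### Quadtree cells over integer points -/

/-- All points of `V` have integer coordinates. -/
def IsIntegral (V : Finset (ℝ × ℝ)) : Prop := ∀ p ∈ V, ∃ i j : ℤ, p = ((i : ℝ), (j : ℝ))

theorem size_eq {k : ℕ} {Q : Cell} (h : Q.level ≤ k + 1) :
    Q.size (2 ^ (k + 1)) = 2 ^ (k + 1 - Q.level) := by
  rw [Cell.size, div_eq_iff (by positivity), ← pow_add, Nat.sub_add_cancel h]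

/-- Cells of level `k + 1` are half-open unit squares and hold one lattice point, so the subdivision
stops there. -/
theorem count_le_one_of_level {k : ℕ} {V : Finset (ℝ × ℝ)} (hV : IsIntegral V) {Q : Cell}
    (h : Q.level = k + 1) : Q.count (2 ^ (k + 1)) V ≤ 1 := by
  classical
  have hs : Q.size (2 ^ (k + 1)) = 1 := by rw [size_eq h.le, h]; simp
  have key : ∀ p ∈ V, p ∈ Q.halfOpenSquare (2 ^ (k + 1)) → p = ((Q.col : ℝ), (Q.row : ℝ)) := by
    intro p hp hpQ
    obtain ⟨i, j, rfl⟩ := hV p hp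
    simp only [Cell.halfOpenSquare, Cell.xmin, Cell.xmax, Cell.ymin, Cell.ymax, hs, mul_one,
      Set.mem_prod, Set.mem_Ico] at hpQ
    obtain ⟨⟨h1, h2⟩, h3, h4⟩ := hpQ
    have h1' : (Q.col : ℤ) ≤ i := by exact_mod_cast h1
    have h2' : i < Q.col + 1 := by exact_mod_cast h2
    have h3' : (Q.row : ℤ) ≤ j := by exact_mod_cast h3
    have h4' : j < Q.row + 1 := by exact_mod_cast h4
    have hi : i = Q.col := by omega
    have hj : j = Q.row := by omega
    simp [hi, hj]
  unfold Cell.count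
  refine Finset.card_le_one.2 fun p hp q hq => ?_
  rw [Finset.mem_filter] at hp hq
  rw [key p hp.1 hp.2, key q hq.1 hq.2]

theorem level_le {k : ℕ} {V : Finset (ℝ × ℝ)} (hV : IsIntegral V) {Q : Cell}
    (hQ : InQuadtree (2 ^ (k + 1)) V Q) : Q.level ≤ k + 1 := by
  induction hQ with
  | root => simp
  | child Q i j _ hc ih =>
    have : Q.level ≠ k + 1 := fun h => by
      have := count_le_one_of_level (k := k) hV h
      omega
    change Q.level + 1 ≤ k + 1
    omega

theorem inQuadtree_ancestor {D : ℝ} {V : Finset (ℝ × ℝ)} {Q : Cell} (hQ : InQuadtree D V Q) :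
    ∀ d ≤ Q.level, InQuadtree D V ⟨Q.level - d, Q.col / 2 ^ d, Q.row / 2 ^ d⟩ := by
  induction hQ with
  | root =>
    intro d hd
    obtain rfl : d = 0 := Nat.le_zero.1 hd
    exact InQuadtree.root
  | child Q i j hQ hc ih =>
    intro d hd
    cases d with
    | zero => simpa using InQuadtree.child Q i j hQ hc
    | succ d =>
      have hhalf : ∀ (a : ℕ) (i : Fin 2), (2 * a + i) / 2 ^ (d + 1) = a / 2 ^ d := by
        intro a i
        rw [pow_succ', ← Nat.div_div_eq_div_mul]
        congr 1
        omega
      have h := ih d (Nat.le_of_succ_le_succ hd)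
      have hl : (Q.child i j).level - (d + 1) = Q.level - d := by
        change Q.level + 1 - (d + 1) = _
        omega
      rw [hl]
      change InQuadtree D V ⟨_, (2 * Q.col + i) / 2 ^ (d + 1), (2 * Q.row + j) / 2 ^ (d + 1)⟩
      rwa [hhalf, hhalf]

theorem xmin_eq {k : ℕ} {Q : Cell} (h : Q.level ≤ k + 1) :
    Q.xmin (2 ^ (k + 1)) = (((Q.col : ℤ) * 2 ^ (k + 1 - Q.level) : ℤ) : ℝ) := by
  rw [Cell.xmin, size_eq h]; push_cast; ring

theorem xmax_eq {k : ℕ} {Q : Cell} (h : Q.level ≤ k + 1) :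
    Q.xmax (2 ^ (k + 1)) = ((((Q.col : ℤ) + 1) * 2 ^ (k + 1 - Q.level) : ℤ) : ℝ) := by
  rw [Cell.xmax, size_eq h]; push_cast; ring

theorem ymin_eq {k : ℕ} {Q : Cell} (h : Q.level ≤ k + 1) :
    Q.ymin (2 ^ (k + 1)) = (((Q.row : ℤ) * 2 ^ (k + 1 - Q.level) : ℤ) : ℝ) := by
  rw [Cell.ymin, size_eq h]; push_cast; ring

theorem ymax_eq {k : ℕ} {Q : Cell} (h : Q.level ≤ k + 1) :
    Q.ymax (2 ^ (k + 1)) = ((((Q.row : ℤ) + 1) * 2 ^ (k + 1 - Q.level) : ℤ) : ℝ) := by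
  rw [Cell.ymax, size_eq h]; push_cast; ring

theorem ymin_lt_ymax {k : ℕ} (Q : Cell) : Q.ymin (2 ^ (k + 1)) < Q.ymax (2 ^ (k + 1)) := by
  unfold Cell.ymin Cell.ymax Cell.size
  have : (0 : ℝ) < 2 ^ (k + 1) / 2 ^ Q.level := by positivity
  linarith

/-! ### Leaf cells -/

/-- The unit cell `c` is contained in the cell `Q`. -/
def ContainsUnit (D : ℝ) (Q : Cell) (c : ℤ × ℤ) : Prop :=
  (Q.xmin D ≤ c.1 ∧ (c.1 : ℝ) + 1 ≤ Q.xmax D) ∧ (Q.ymin D ≤ c.2 ∧ (c.2 : ℝ) + 1 ≤ Q.ymax D)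

theorem ContainsUnit.mem_square {D : ℝ} {Q : Cell} {c : ℤ × ℤ} (h : ContainsUnit D Q c)
    {p : ℝ × ℝ} (hp : InUnitCell c p) : p ∈ Q.square D :=
  ⟨⟨h.1.1.trans hp.1.1, hp.1.2.trans h.1.2⟩, ⟨h.2.1.trans hp.2.1, hp.2.2.trans h.2.2⟩⟩

theorem ContainsUnit.of_subset {D : ℝ} {P Q : Cell} {c : ℤ × ℤ} (h : ContainsUnit D P c)
    (hPQ : P.square D ⊆ Q.square D) : ContainsUnit D Q c := by
  have h1 := hPQ (h.mem_square (p := ((c.1 : ℝ), (c.2 : ℝ))) (by simp [InUnitCell]))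
  have h2 := hPQ (h.mem_square (p := ((c.1 : ℝ) + 1, (c.2 : ℝ) + 1)) (by simp [InUnitCell]))
  exact ⟨⟨h1.1.1, h2.1.2⟩, ⟨h1.2.1, h2.2.2⟩⟩

/-- The descent through the cells `Qt t` around `c` stays in the quadtree until it meets a leaf, at
level `k + 1` at the latest. -/
theorem exists_leaf {k : ℕ} {V : Finset (ℝ × ℝ)} (hV : IsIntegral V) {c : ℤ × ℤ}
    (hc : InRoot k c) : ∃ Q, IsLeaf (2 ^ (k + 1)) V Q ∧ ContainsUnit (2 ^ (k + 1)) Q c := by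
  obtain ⟨i, j⟩ := c
  obtain ⟨⟨hi, hi'⟩, hj, hj'⟩ := hc
  dsimp only at hi hj hi' hj'
  lift i to ℕ using hi
  lift j to ℕ using hj
  have hi2 : i < 2 ^ (k + 1) := by exact_mod_cast hi'
  have hj2 : j < 2 ^ (k + 1) := by exact_mod_cast hj'
  let Qt : ℕ → Cell := fun t => ⟨t, i / 2 ^ (k + 1 - t), j / 2 ^ (k + 1 - t)⟩
  have hcont : ∀ t ≤ k + 1, ContainsUnit (2 ^ (k + 1)) (Qt t) ((i : ℤ), (j : ℤ)) := by
    intro t ht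
    have hp : 0 < 2 ^ (k + 1 - t) := by positivity
    have hlow : ∀ a : ℕ, a / 2 ^ (k + 1 - t) * 2 ^ (k + 1 - t) ≤ a := fun a =>
      Nat.div_mul_le_self _ _
    have hup : ∀ a : ℕ, a + 1 ≤ (a / 2 ^ (k + 1 - t) + 1) * 2 ^ (k + 1 - t) := fun a => by
      have := Nat.lt_div_mul_add hp (a := a)
      rw [add_mul, one_mul]
      omega
    have hlow' : ∀ a : ℕ, ((a / 2 ^ (k + 1 - t) : ℕ) : ℝ) * 2 ^ (k + 1 - t) ≤ ((a : ℤ) : ℝ) := by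
      intro a
      have := (Nat.cast_le (α := ℝ)).2 (hlow a)
      rwa [Nat.cast_mul, Nat.cast_pow, Nat.cast_ofNat] at this
    have hup' : ∀ a : ℕ, ((a : ℤ) : ℝ) + 1 ≤
        (((a / 2 ^ (k + 1 - t) : ℕ) : ℝ) + 1) * 2 ^ (k + 1 - t) := by
      intro a
      have := (Nat.cast_le (α := ℝ)).2 (hup a)
      rwa [Nat.cast_mul, Nat.cast_pow, Nat.cast_ofNat, Nat.cast_add, Nat.cast_add,
        Nat.cast_one] at this
    unfold ContainsUnit Cell.xmin Cell.xmax Cell.ymin Cell.ymax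
    rw [size_eq (Q := Qt t) ht]
    exact ⟨⟨hlow' i, hup' i⟩, hlow' j, hup' j⟩
  have key : ∀ t ≤ k + 1, (∃ Q, IsLeaf (2 ^ (k + 1)) V Q ∧
      ContainsUnit (2 ^ (k + 1)) Q ((i : ℤ), (j : ℤ))) ∨ InQuadtree (2 ^ (k + 1)) V (Qt t) := by
    intro t
    induction t with
    | zero =>
      intro _
      right
      simp only [Qt, Nat.sub_zero, Nat.div_eq_of_lt hi2, Nat.div_eq_of_lt hj2]
      exact InQuadtree.root
    | succ t ih =>
      intro ht
      rcases ih (by omega) with h | h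
      · exact Or.inl h
      · rcases Nat.lt_or_ge 1 ((Qt t).count (2 ^ (k + 1)) V) with hc | hc
        · right
          have hdiv : ∀ a : ℕ, 2 * (a / 2 ^ (k + 1 - t)) + a / 2 ^ (k + 1 - (t + 1)) % 2 =
              a / 2 ^ (k + 1 - (t + 1)) := by
            intro a
            rw [show k + 1 - t = k + 1 - (t + 1) + 1 by omega, pow_succ,
              ← Nat.div_div_eq_div_mul]
            exact Nat.div_add_mod _ 2
          have h' := InQuadtree.child (Qt t) ⟨i / 2 ^ (k + 1 - (t + 1)) % 2, Nat.mod_lt _ two_pos⟩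
            ⟨j / 2 ^ (k + 1 - (t + 1)) % 2, Nat.mod_lt _ two_pos⟩ h hc
          simpa only [Cell.child, Qt, hdiv] using h'
        · exact Or.inl ⟨_, ⟨h, hc⟩, hcont t (by omega)⟩
  rcases key (k + 1) le_rfl with h | h
  · exact h
  · exact ⟨_, ⟨h, count_le_one_of_level hV rfl⟩, hcont _ le_rfl⟩

/-! ### Reflection -/

/-- The reflection of a cell in the diagonal. -/
def swapCell (Q : Cell) : Cell := ⟨Q.level, Q.row, Q.col⟩

/-- The reflection of a side in the diagonal. -/
def swapDir : Dir → Dir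
  | .left => .bottom
  | .right => .top
  | .bottom => .left
  | .top => .right

theorem swapDir_swapDir (d : Dir) : swapDir (swapDir d) = d := by cases d <;> rfl

theorem swap_mem_side {D : ℝ} {Q : Cell} {d : Dir} {p : ℝ × ℝ} :
    p.swap ∈ (swapCell Q).side D (swapDir d) ↔ p ∈ Q.side D d := by
  cases d <;> exact and_comm

theorem swap_mem_openSide {D : ℝ} {Q : Cell} {d : Dir} {p : ℝ × ℝ} :
    p.swap ∈ (swapCell Q).openSide D (swapDir d) ↔ p ∈ Q.openSide D d := by
  cases d <;> exact and_comm

theorem swap_side_subset {D : ℝ} {P Q : Cell} {d e : Dir} :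
    (swapCell P).side D (swapDir d) ⊆ (swapCell Q).side D (swapDir e) ↔
      P.side D d ⊆ Q.side D e := by
  constructor
  · exact fun h p hp => swap_mem_side.1 (h (swap_mem_side.2 hp))
  · intro h p hp
    rw [← p.swap_swap] at hp ⊢
    exact swap_mem_side.2 (h (swap_mem_side.1 hp))

theorem swap_sidePoint {D : ℝ} {m : ℕ} {Q : Cell} {d : Dir} {t : ℕ} :
    (swapCell Q).sidePoint D m (swapDir d) t = (Q.sidePoint D m d t).swap := by
  cases d <;> rfl

theorem count_swap (D : ℝ) (V : Finset (ℝ × ℝ)) (Q : Cell) :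
    (swapCell Q).count D (V.image Prod.swap) = Q.count D V := by
  classical
  unfold Cell.count
  rw [Finset.filter_image, Finset.card_image_of_injective _ Prod.swap_injective]
  congr 1
  ext p
  simp only [Finset.mem_filter]
  exact and_congr_right fun _ => and_comm

theorem InQuadtree.swap {D : ℝ} {V : Finset (ℝ × ℝ)} {Q : Cell} (h : InQuadtree D V Q) :
    InQuadtree D (V.image Prod.swap) (swapCell Q) := by
  induction h with
  | root => exact InQuadtree.root
  | child Q i j _ hc ih => exact InQuadtree.child _ j i ih (by rwa [count_swap])

theorem image_swap_image_swap {α : Type*} [DecidableEq α] (V : Finset (α × α)) :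
    (V.image Prod.swap).image Prod.swap = V := by
  rw [Finset.image_image]; simp

theorem IsPortal.swap {D : ℝ} {V : Finset (ℝ × ℝ)} {m : ℕ} {Q : Cell} {d : Dir} {p : ℝ × ℝ}
    (h : IsPortal D V m Q d p) :
    IsPortal D (V.image Prod.swap) m (swapCell Q) (swapDir d) p.swap := by
  obtain ⟨h1, Q₀, d₀, h2, h3, h4, t, ht, rfl⟩ := h
  refine ⟨swap_mem_side.2 h1, swapCell Q₀, swapDir d₀, h2.swap, swap_side_subset.2 h3, ?_, t, ht,
    swap_sidePoint.symm⟩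
  intro Q₁ d₁ hQ₁ hsub
  have h5 := hQ₁.swap
  rw [image_swap_image_swap] at h5
  refine h4 (swapCell Q₁) (swapDir d₁) h5 (swap_side_subset.1 ?_)
  rw [swapDir_swapDir]
  exact hsub

/-! ### Portals and crossings on vertical sides -/

/-- The position of the vertical line through the left or right side of a cell. -/
def sideLine (k : ℕ) (Q : Cell) : Dir → ℤ
  | .left => (Q.col : ℤ) * 2 ^ (k + 1 - Q.level)
  | .right => ((Q.col : ℤ) + 1) * 2 ^ (k + 1 - Q.level)
  | _ => 0

theorem mem_vertical_side {k : ℕ} {Q : Cell} (hl : Q.level ≤ k + 1) {d : Dir}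
    (hd : d = .left ∨ d = .right) {p : ℝ × ℝ} :
    p ∈ Q.side (2 ^ (k + 1)) d ↔
      p.1 = sideLine k Q d ∧ Q.ymin (2 ^ (k + 1)) ≤ p.2 ∧ p.2 ≤ Q.ymax (2 ^ (k + 1)) := by
  rcases hd with rfl | rfl
  · rw [sideLine, ← xmin_eq hl]; rfl
  · rw [sideLine, ← xmax_eq hl]; rfl

theorem mem_vertical_openSide {k : ℕ} {Q : Cell} (hl : Q.level ≤ k + 1) {d : Dir}
    (hd : d = .left ∨ d = .right) {p : ℝ × ℝ} :
    p ∈ Q.openSide (2 ^ (k + 1)) d ↔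
      p.1 = sideLine k Q d ∧ Q.ymin (2 ^ (k + 1)) < p.2 ∧ p.2 < Q.ymax (2 ^ (k + 1)) := by
  rcases hd with rfl | rfl
  · rw [sideLine, ← xmin_eq hl]; rfl
  · rw [sideLine, ← xmax_eq hl]; rfl

theorem pow_dvd_sideLine (k : ℕ) (Q : Cell) (d : Dir) :
    (2 : ℤ) ^ (k + 1 - Q.level) ∣ sideLine k Q d := by
  cases d <;> simp [sideLine]

/-- No line strictly inside the root cell is divisible by `2 ^ (k + 1)`, so the cap `k` on heights
loses nothing. -/
theorem le_lineHeight_of_dvd {k h : ℕ} {n : ℤ} (hn0 : 0 < n) (hn : n < 2 ^ (k + 1))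
    (hd : (2 : ℤ) ^ h ∣ n) : h ≤ lineHeight k n := by
  refine le_lineHeight ?_ hd
  by_contra hlt
  push Not at hlt
  have h1 : (2 : ℤ) ^ (k + 1) ∣ n := (pow_dvd_pow 2 hlt).trans hd
  have := Int.le_of_dvd hn0 h1
  omega

/-- A vertical segment of positive length fits only into a vertical side, so both sides are on one
line, whose position is a multiple of the size of `P`. This bounds the cells competing for the
lowest level. -/
theorem sideLine_dvd_of_subset {k : ℕ} {P Q : Cell} (hP : P.level ≤ k + 1) (hQ : Q.level ≤ k + 1)
    {d e : Dir} (hd : d = .left ∨ d = .right)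
    (h : Q.side (2 ^ (k + 1)) d ⊆ P.side (2 ^ (k + 1)) e) :
    (2 : ℤ) ^ (k + 1 - P.level) ∣ sideLine k Q d := by
  have hy := ymin_lt_ymax (k := k) Q
  have h1 := h ((mem_vertical_side hQ hd (p := ((sideLine k Q d : ℝ), Q.ymin (2 ^ (k + 1))))).2
    ⟨rfl, le_rfl, hy.le⟩)
  have h2 := h ((mem_vertical_side hQ hd (p := ((sideLine k Q d : ℝ), Q.ymax (2 ^ (k + 1))))).2
    ⟨rfl, hy.le, le_rfl⟩)
  have hv : e = .left ∨ e = .right := by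
    cases e with
    | left => exact Or.inl rfl
    | right => exact Or.inr rfl
    | bottom => exact absurd (h1.2.trans h2.2.symm) hy.ne
    | top => exact absurd (h1.2.trans h2.2.symm) hy.ne
  have h3 := ((mem_vertical_side hP hv).1 h1).1
  have h4 : sideLine k Q d = sideLine k P e := Int.cast_injective h3
  rw [h4]
  exact pow_dvd_sideLine k P e

/-- If the line has height `H`, the lowest level is attained by the ancestor of `Q` of side length
`2 ^ H`. Its corners are multiples of `2 ^ H`, so its portals are exactly the multiples of the
spacing on its side. -/
theorem isPortal_of_eq_mul {k m : ℕ} {V : Finset (ℝ × ℝ)} (hV : IsIntegral V) {Q : Cell}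
    (hQ : InQuadtree (2 ^ (k + 1)) V Q) {d : Dir} (hd : d = .left ∨ d = .right)
    (hn0 : 0 < sideLine k Q d) (hn : sideLine k Q d < 2 ^ (k + 1)) {p : ℝ × ℝ}
    (hp : p ∈ Q.side (2 ^ (k + 1)) d) {t : ℤ}
    (ht : p.2 = t * spacing m (lineHeight k (sideLine k Q d))) :
    IsPortal (2 ^ (k + 1)) V m Q d p := by
  have hl := level_le hV hQ
  set n := sideLine k Q d with hn_def
  set H := lineHeight k n with hH
  set h := k + 1 - Q.level with hh
  have hhH : h ≤ H := le_lineHeight_of_dvd hn0 hn (pow_dvd_sideLine k Q d)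
  have hHk : H ≤ k := lineHeight_le k n
  obtain ⟨g, hg⟩ := Nat.exists_eq_add_of_le hhH
  have hgl : g ≤ Q.level := by omega
  set Q₀ : Cell := ⟨Q.level - g, Q.col / 2 ^ g, Q.row / 2 ^ g⟩ with hQ₀
  have hQ₀t : InQuadtree (2 ^ (k + 1)) V Q₀ := inQuadtree_ancestor hQ g hgl
  have hl₀ : Q₀.level ≤ k + 1 := level_le hV hQ₀t
  have hlev : k + 1 - Q₀.level = H := by
    change k + 1 - (Q.level - g) = H
    omega
  -- Since `2 ^ H` divides `n`, passing to the ancestor keeps the line: the column, or the column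
  -- plus one for a right side, is a multiple of `2 ^ g`.
  have hline : sideLine k Q₀ d = n := by
    obtain ⟨c, hc⟩ := pow_lineHeight_dvd k n
    rw [← hH, hg, pow_add] at hc
    have hpos : (0 : ℤ) < 2 ^ h := by positivity
    have hpos' : (0 : ℤ) < 2 ^ g := by positivity
    have hcol : ((Q.col / 2 ^ g : ℕ) : ℤ) = (Q.col : ℤ) / 2 ^ g := by push_cast; rfl
    rcases hd with rfl | rfl
    · simp only [sideLine] at hn_def
      have h1 : (Q.col : ℤ) = c * 2 ^ g :=
        mul_right_cancel₀ hpos.ne' (by rw [← hn_def, hc]; ring)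
      simp only [sideLine, hlev]
      change ((Q.col / 2 ^ g : ℕ) : ℤ) * 2 ^ H = n
      rw [hcol, h1, Int.mul_ediv_cancel _ hpos'.ne', hc, hg, pow_add]
      ring
    · simp only [sideLine] at hn_def
      have h1 : (Q.col : ℤ) + 1 = c * 2 ^ g :=
        mul_right_cancel₀ hpos.ne' (by rw [← hn_def, hc]; ring)
      have h2 : (Q.col : ℤ) / 2 ^ g = c - 1 := by
        rw [ediv_pow_eq_iff]
        constructor <;> nlinarith
      simp only [sideLine, hlev]
      change (((Q.col / 2 ^ g : ℕ) : ℤ) + 1) * 2 ^ H = n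
      rw [hcol, h2, hc, hg, pow_add]
      ring
  have hy : Q₀.ymin (2 ^ (k + 1)) ≤ Q.ymin (2 ^ (k + 1)) ∧
      Q.ymax (2 ^ (k + 1)) ≤ Q₀.ymax (2 ^ (k + 1)) := by
    rw [ymin_eq hl, ymax_eq hl, ymin_eq hl₀, ymax_eq hl₀, hlev, ← hh, hg, pow_add]
    have h1 : Q.row / 2 ^ g * 2 ^ g ≤ Q.row := Nat.div_mul_le_self _ _
    have h2 : Q.row + 1 ≤ (Q.row / 2 ^ g + 1) * 2 ^ g := by
      have := Nat.lt_div_mul_add (a := Q.row) (b := 2 ^ g) (by positivity)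
      rw [add_mul, one_mul]
      omega
    have h1' : Q.row / 2 ^ g * (2 ^ h * 2 ^ g) ≤ Q.row * 2 ^ h :=
      (Nat.mul_le_mul_right (2 ^ h) h1).trans_eq' (by ring)
    have h2' : (Q.row + 1) * 2 ^ h ≤ (Q.row / 2 ^ g + 1) * (2 ^ h * 2 ^ g) :=
      (Nat.mul_le_mul_right (2 ^ h) h2).trans_eq (by ring)
    constructor
    · exact_mod_cast h1'
    · exact_mod_cast h2'
  obtain ⟨hp1, hp2, hp3⟩ := (mem_vertical_side hl hd).1 hp
  have hsub : Q.side (2 ^ (k + 1)) d ⊆ Q₀.side (2 ^ (k + 1)) d := by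
    intro q hq
    obtain ⟨hq1, hq2, hq3⟩ := (mem_vertical_side hl hd).1 hq
    refine (mem_vertical_side hl₀ hd).2 ⟨?_, hy.1.trans hq2, hq3.trans hy.2⟩
    rw [hline, hq1]
  refine ⟨hp, Q₀, d, hQ₀t, hsub, ?_, ?_⟩
  · intro Q₁ d₁ hQ₁ hsub₁
    have hl₁ := level_le hV hQ₁
    have := le_lineHeight_of_dvd hn0 hn (sideLine_dvd_of_subset hl₁ hl hd hsub₁)
    omega
  · have hs : Q₀.size (2 ^ (k + 1)) = 2 ^ H := by rw [size_eq hl₀, hlev]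
    have hb1 : Q₀.ymin (2 ^ (k + 1)) ≤ p.2 := hy.1.trans hp2
    have hb2 : p.2 ≤ Q₀.ymax (2 ^ (k + 1)) := hp3.trans hy.2
    have hmp : (0 : ℝ) < m + 1 := by positivity
    have hpow : (0 : ℝ) < 2 ^ H := by positivity
    have hsp : spacing m H * (m + 1) = 2 ^ H := by unfold spacing; field_simp
    have hspos := spacing_pos m H
    rw [Cell.ymin, hs, ht] at hb1
    rw [Cell.ymax, hs, ht] at hb2
    have ht1 : (0 : ℤ) ≤ t - Q₀.row * (m + 1) := by
      have : (Q₀.row : ℝ) * (m + 1) ≤ t := by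
        refine le_of_mul_le_mul_right ?_ hspos
        calc (Q₀.row : ℝ) * (m + 1) * spacing m H = Q₀.row * 2 ^ H := by rw [← hsp]; ring
          _ ≤ _ := hb1
      have : (Q₀.row : ℤ) * (m + 1) ≤ t := by exact_mod_cast this
      omega
    have ht2 : t - Q₀.row * (m + 1) ≤ m + 1 := by
      have : (t : ℝ) ≤ (Q₀.row + 1) * (m + 1) := by
        refine le_of_mul_le_mul_right ?_ hspos
        calc (t : ℝ) * spacing m H ≤ (Q₀.row + 1) * 2 ^ H := hb2
          _ = _ := by rw [← hsp]; ring
      have : t ≤ (Q₀.row + 1) * (m + 1) := by exact_mod_cast this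
      linarith
    obtain ⟨τ, hτ⟩ := Int.eq_ofNat_of_zero_le ht1
    refine ⟨τ, by omega, ?_⟩
    have hτ' : (t : ℝ) = Q₀.row * (m + 1) + τ := by
      have : t = Q₀.row * (m + 1) + τ := by linarith
      rw [this]
      push_cast
      ring
    have hpy : p.2 = Q₀.ymin (2 ^ (k + 1)) + τ / (m + 1) * Q₀.size (2 ^ (k + 1)) := by
      rw [ht, hτ', Cell.ymin, hs, ← hsp]
      field_simp
    have hpx : p.1 = sideLine k Q₀ d := by rw [hp1, hline]
    rcases hd with rfl | rfl
    · exact Prod.ext (hpx.trans (xmin_eq hl₀).symm) hpy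
    · exact Prod.ext (hpx.trans (xmax_eq hl₀).symm) hpy

/-- The conditions on a side for light trees, for a set `S` of crossing nodes. -/
theorem vertical_side_light {k m r : ℕ} (hr : 0 < r) {V : Finset (ℝ × ℝ)} (hV : IsIntegral V)
    {H : Finset (ℤ × ℤ)} {Q : Cell} (hQ : InQuadtree (2 ^ (k + 1)) V Q) {d : Dir}
    (hd : d = .left ∨ d = .right) (S : Set Node)
    (hS : ∀ w ∈ S, w.2 ∈ Q.side (2 ^ (k + 1)) d ∧ (0 < w.1.1 ∧ w.1.1 < 2 ^ (k + 1)) ∧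
      w.1.1 = sideLine k Q d ∧ MayCross k r m H w) :
    (∀ w ∈ S, IsPortal (2 ^ (k + 1)) V m Q d w.2) ∧
      {w ∈ S | w.2 ∈ Q.openSide (2 ^ (k + 1)) d}.Finite ∧
      {w ∈ S | w.2 ∈ Q.openSide (2 ^ (k + 1)) d}.ncard ≤ r := by
  have hl := level_le hV hQ
  constructor
  · intro w hw
    obtain ⟨h1, ⟨h2, h3⟩, h4, h5⟩ := hS w hw
    obtain ⟨t, ht⟩ := h5.exists_eq_mul
    rw [h4] at h2 h3 ht
    exact isPortal_of_eq_mul hV hQ hd h2 h3 h1 ht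
  · rcases S.eq_empty_or_nonempty with rfl | ⟨w₀, hw₀⟩
    · simp
    · obtain ⟨-, ⟨h2, h3⟩, h4, -⟩ := hS w₀ hw₀
      rw [h4] at h2 h3
      refine mayCross_ncard_le (m := m) (H := H) hr
        (le_lineHeight_of_dvd h2 h3 (pow_dvd_sideLine k Q d)) Q.row _ ?_
      rintro w ⟨hw, ho⟩
      obtain ⟨-, -, h6, h7⟩ := hS w hw
      have h8 := ((mem_vertical_openSide hl hd).1 ho).2
      rw [ymin_eq hl, ymax_eq hl] at h8
      exact ⟨h6, h7, h8⟩

theorem column_lt_of_beyond {k : ℕ} {P Q : Cell} (hQ : Q.level ≤ k + 1) {d : Dir}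
    (hd : d = .left ∨ d = .right) {c e : ℤ × ℤ} (hc : ContainsUnit (2 ^ (k + 1)) Q c)
    (he : ContainsUnit (2 ^ (k + 1)) P e) (h : Q.Beyond (2 ^ (k + 1)) d P) :
    (c.1 < sideLine k Q d ∧ sideLine k Q d ≤ e.1) ∨
      (e.1 < sideLine k Q d ∧ sideLine k Q d ≤ c.1) := by
  rcases hd with rfl | rfl
  · right
    have h1 : (e.1 : ℝ) + 1 ≤ Q.xmin (2 ^ (k + 1)) := he.1.2.trans h
    have h2 := hc.1.1
    rw [xmin_eq hQ] at h1 h2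
    exact ⟨by exact_mod_cast h1, by exact_mod_cast h2⟩
  · left
    have h1 : Q.xmax (2 ^ (k + 1)) ≤ (e.1 : ℝ) := le_trans h he.1.1
    have h2 := hc.1.2
    rw [xmax_eq hQ] at h1 h2
    exact ⟨by exact_mod_cast h2, by exact_mod_cast h1⟩

theorem Cell.Beyond.swap {D : ℝ} {Q R : Cell} {d : Dir} (h : Q.Beyond D d R) :
    (swapCell Q).Beyond D (swapDir d) (swapCell R) := by
  cases d <;> exact h

theorem ContainsUnit.swap {D : ℝ} {Q : Cell} {c : ℤ × ℤ} (h : ContainsUnit D Q c) :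
    ContainsUnit D (swapCell Q) c.swap := And.symm h

theorem IsIntegral.swap {V : Finset (ℝ × ℝ)} (hV : IsIntegral V) :
    IsIntegral (V.image Prod.swap) := by
  intro p hp
  obtain ⟨q, hq, rfl⟩ := Finset.mem_image.1 hp
  obtain ⟨i, j, rfl⟩ := hV q hq
  exact ⟨j, i, rfl⟩

theorem swapNode_injective : Function.Injective swapNode := fun _ _ h =>
  Prod.ext (Prod.swap_injective (congrArg Prod.fst h)) (Prod.swap_injective (congrArg Prod.snd h))

/-! ### Construction of the light tree -/

/-- A drawn graph whose edges satisfy `EdgeSpec` contains a light tree. -/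
theorem exists_light_tree {k m r : ℕ} (hr : 0 < r) {H K : Finset (ℤ × ℤ)}
    {E : Finset (Node × Node)} (hE : ∀ e ∈ E, EdgeSpec k r m H K e) {V : Finset (ℝ × ℝ)}
    (hV : IsIntegral V) (w₀ : Node)
    (hw₀ : ∀ p ∈ V, ∃ w : Node, (pairGraph E).Reachable w₀ w ∧ w.2 = p) :
    ∃ T : SteinerTree V, T.IsLight (2 ^ (k + 1)) m r ∧ T.length ≤ pairLength Prod.snd E := by
  obtain ⟨T, φ, hφ, hpos, hadj, hlen⟩ :=
    exists_steinerTree E Prod.snd (fun e he => (hE e he).1) V w₀ hw₀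
  refine ⟨T, ?_, hlen⟩
  -- Unit cells outside the root do not occur at edges. They get an arbitrary value to make `leaf`
  -- total.
  have hleaf : ∀ c : ℤ × ℤ, ∃ Q, InRoot k c →
      IsLeaf (2 ^ (k + 1)) V Q ∧ ContainsUnit (2 ^ (k + 1)) Q c := by
    intro c
    by_cases hc : InRoot k c
    · obtain ⟨Q, hQ⟩ := exists_leaf hV hc
      exact ⟨Q, fun _ => hQ⟩
    · exact ⟨⟨0, 0, 0⟩, fun h => absurd h hc⟩
  choose leaf hleaf using hleaf
  refine ⟨fun e => leaf (unitCell (e.map φ)), fun u v huv => ?_, fun Q d hQ => ?_⟩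
  · obtain ⟨h1, h2, h3⟩ := spec_of_adj hE (hadj u v huv)
    obtain ⟨h4, h5⟩ := hleaf _ h3
    rw [hpos, hpos]
    exact ⟨h4, h5.mem_square h1, h5.mem_square h2⟩
  set cell : Sym2 (Fin T.n) → Cell := fun e => leaf (unitCell (e.map φ)) with hcell
  have hl := level_le hV hQ
  have hcross : ∀ v, T.CrossesAt (2 ^ (k + 1)) cell Q d v → T.pos v ∈ Q.side (2 ^ (k + 1)) d ∧
      ∃ u w, (pairGraph E).Adj (φ v) u ∧ (pairGraph E).Adj (φ v) w ∧
        InRoot k (unitCell s(φ v, u)) ∧ InRoot k (unitCell s(φ v, w)) ∧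
        ContainsUnit (2 ^ (k + 1)) Q (unitCell s(φ v, u)) ∧
        ∃ P, ContainsUnit (2 ^ (k + 1)) P (unitCell s(φ v, w)) ∧
          Q.Beyond (2 ^ (k + 1)) d P := by
    rintro v ⟨hs, u, w, hu, hw, h1, h2⟩
    obtain ⟨-, -, h3⟩ := spec_of_adj hE (hadj v u hu)
    obtain ⟨-, -, h4⟩ := spec_of_adj hE (hadj v w hw)
    exact ⟨hs, φ u, φ w, hadj v u hu, hadj v w hw, h3, h4, (hleaf _ h3).2.of_subset h1, _,
      (hleaf _ h4).2, h2⟩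
  have hdir : (d = .left ∨ d = .right) ∨ (swapDir d = .left ∨ swapDir d = .right) := by
    cases d <;> simp [swapDir]
  rcases hdir with hd | hd
  · obtain ⟨h1, h2, h3⟩ := vertical_side_light (m := m) hr hV (H := H) hQ hd
      (φ '' {v | T.CrossesAt (2 ^ (k + 1)) cell Q d v}) (by
        rintro _ ⟨v, hv, rfl⟩
        obtain ⟨hs, u, w, hu, hw, hu1, hw1, hQu, P, hP, hPb⟩ := hcross v hv
        rw [hpos] at hs
        refine ⟨hs, ?_⟩
        obtain ⟨⟨hu0, hu2⟩, -⟩ := hu1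
        obtain ⟨⟨hw0, hw2⟩, -⟩ := hw1
        rcases column_lt_of_beyond hl hd hQu hP hPb with ⟨ha, hb⟩ | ⟨ha, hb⟩
        · obtain ⟨h1, h2⟩ := mayCross_of_column_lt hE hu hw ha hb
          exact ⟨by omega, h1, h2⟩
        · obtain ⟨h1, h2⟩ := mayCross_of_column_lt hE hw hu ha hb
          exact ⟨by omega, h1, h2⟩)
    refine ⟨fun v hv => ?_, ?_⟩
    · rw [hpos]
      exact h1 _ ⟨v, hv, rfl⟩
    · rw [← Set.ncard_image_of_injective _ hφ]
      refine (Set.ncard_le_ncard ?_ h2).trans h3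
      rintro _ ⟨v, ⟨hv, hvo⟩, rfl⟩
      rw [hpos] at hvo
      exact ⟨⟨v, hv, rfl⟩, hvo⟩
  -- Bottom and top sides become vertical by reflection in the diagonal, with the reflected `K` in
  -- the role of `H`.
  · obtain ⟨h1, h2, h3⟩ := vertical_side_light (m := m) hr hV.swap (H := K.image Prod.swap)
      hQ.swap hd ((swapNode ∘ φ) '' {v | T.CrossesAt (2 ^ (k + 1)) cell Q d v}) (by
        rintro _ ⟨v, hv, rfl⟩
        obtain ⟨hs, u, w, hu, hw, hu1, hw1, hQu, P, hP, hPb⟩ := hcross v hv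
        rw [hpos] at hs
        refine ⟨swap_mem_side.2 hs, ?_⟩
        obtain ⟨-, ⟨hu0, hu2⟩⟩ := hu1
        obtain ⟨-, ⟨hw0, hw2⟩⟩ := hw1
        have hrow : (swapNode (φ v)).1.1 = (φ v).1.2 := rfl
        rw [Function.comp_apply, hrow]
        rcases column_lt_of_beyond (Q := swapCell Q) hl hd hQu.swap hP.swap hPb.swap with
          ⟨ha, hb⟩ | ⟨ha, hb⟩
        · obtain ⟨h1, h2⟩ := mayCross_of_row_lt hE hu hw ha hb
          rw [Prod.fst_swap] at ha hb
          exact ⟨by omega, h1, h2⟩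
        · obtain ⟨h1, h2⟩ := mayCross_of_row_lt hE hw hu ha hb
          rw [Prod.fst_swap] at ha hb
          exact ⟨by omega, h1, h2⟩)
    refine ⟨fun v hv => ?_, ?_⟩
    · rw [hpos]
      have h4 := (h1 _ ⟨v, hv, rfl⟩).swap
      rwa [image_swap_image_swap, swapDir_swapDir] at h4
    · rw [← Set.ncard_image_of_injective _ (swapNode_injective.comp hφ)]
      refine (Set.ncard_le_ncard ?_ h2).trans h3
      rintro _ ⟨v, ⟨hv, hvo⟩, rfl⟩
      rw [hpos] at hvo
      exact ⟨⟨v, hv, rfl⟩, swap_mem_openSide.2 hvo⟩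

/-- Unit edges connecting `V₀` can be modified to a light tree, at the cost of `lineCost`. -/
theorem exists_light_tree_of_connects {k m r : ℕ} (hr : 0 < r) {H K V₀ : Finset (ℤ × ℤ)}
    (hH : ∀ p ∈ H, 0 ≤ p.1 ∧ p.1 + 1 < 2 ^ (k + 1) ∧ 0 ≤ p.2 ∧ p.2 < 2 ^ (k + 1))
    (hK : ∀ p ∈ K, 0 ≤ p.1 ∧ p.1 < 2 ^ (k + 1) ∧ 0 ≤ p.2 ∧ p.2 + 1 < 2 ^ (k + 1))
    (hc : Connects H K V₀) {V : Finset (ℝ × ℝ)}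
    (hV : ∀ p ∈ V, ∃ q ∈ V₀, p = ((q.1 : ℝ), (q.2 : ℝ))) :
    ∃ T : SteinerTree V, T.IsLight (2 ^ (k + 1)) m r ∧
      T.length ≤ (H.card + K.card : ℕ) + (∑ n ∈ linesOf H, lineCost k r m H n +
        ∑ n ∈ linesOf (K.image Prod.swap), lineCost k r m (K.image Prod.swap) n) := by
  have hw : ∃ w₀ : Node, ∀ p ∈ V, ∃ w : Node,
      (pairGraph (lightEdges k r m H K)).Reachable w₀ w ∧ w.2 = p := by
    rcases V₀.eq_empty_or_nonempty with rfl | ⟨q₀, hq₀⟩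
    · exact ⟨cornerNode (0, 0), fun p hp => by simpa using hV p hp⟩
    · refine ⟨cornerNode q₀, fun p hp => ?_⟩
      obtain ⟨q, hq, rfl⟩ := hV p hp
      exact ⟨cornerNode q, reachable_lightEdges k r m H K V₀ hc hq₀ hq, rfl⟩
  obtain ⟨w₀, hw₀⟩ := hw
  obtain ⟨T, hT, hlen⟩ := exists_light_tree (m := m) hr (fun e he => edgeSpec_lightEdges hH hK he)
    (fun p hp => by
      obtain ⟨q, -, rfl⟩ := hV p hp
      exact ⟨q.1, q.2, rfl⟩) w₀ hw₀
  exact ⟨T, hT, hlen.trans (pairLength_lightEdges_le k r m H K)⟩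

/-! ### Averaging over the shifts -/

/-- Translation of lattice points by `(a, b)`. -/
def translate (H : Finset (ℤ × ℤ)) (a b : ℕ) : Finset (ℤ × ℤ) :=
  H.image fun p => (p.1 + a, p.2 + b)

theorem translate_injective (a b : ℕ) :
    Function.Injective fun p : ℤ × ℤ => (p.1 + (a : ℤ), p.2 + (b : ℤ)) := by
  intro p q h
  simpa [Prod.ext_iff] using h

theorem card_translate (H : Finset (ℤ × ℤ)) (a b : ℕ) : (translate H a b).card = H.card :=
  Finset.card_image_of_injective _ (translate_injective a b)

theorem Connects.translate {H K V : Finset (ℤ × ℤ)} (h : Connects H K V) (a b : ℕ) :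
    Connects (translate H a b) (translate K a b) (translate V a b) := by
  intro s hH hK p hp q hq
  obtain ⟨p', hp', rfl⟩ := Finset.mem_image.1 hp
  obtain ⟨q', hq', rfl⟩ := Finset.mem_image.1 hq
  refine h (s.comap fun p : ℤ × ℤ => (p.1 + (a : ℤ), p.2 + (b : ℤ))) (fun z hz => ?_)
    (fun z hz => ?_) p' hp' q' hq'
  · have := hH _ (Finset.mem_image_of_mem _ hz)
    rw [Setoid.comap_rel]
    convert this using 2
    ring
  · have := hK _ (Finset.mem_image_of_mem _ hz)
    rw [Setoid.comap_rel]
    convert this using 2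
    ring

/-- The shift `a` moves the line without changing its request set. The thinning therefore depends on
`b` alone and stays fixed while `a` varies. -/
theorem rows_translate (H : Finset (ℤ × ℤ)) (a b : ℕ) (n : ℤ) :
    rows (translate H a b) (n + a) = (rows H n).image fun y => y + (b : ℤ) := by
  ext y
  rw [mem_rows]
  simp only [translate, Finset.mem_image, mem_rows, Prod.ext_iff, Prod.exists]
  constructor
  · rintro ⟨i, j, h, h1, rfl⟩
    exact ⟨j, by rwa [show n - 1 = i by linarith], rfl⟩
  · rintro ⟨j, h, rfl⟩
    exact ⟨n - 1, j, h, by ring, rfl⟩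

theorem linesOf_translate (H : Finset (ℤ × ℤ)) (a b : ℕ) :
    linesOf (translate H a b) = (linesOf H).image fun n => n + (a : ℤ) := by
  simp only [linesOf, translate, Finset.image_image]
  refine Finset.image_congr fun p _ => ?_
  simp only [Function.comp_apply]
  ring

theorem sum_card_rows_le (H : Finset (ℤ × ℤ)) :
    ∑ n ∈ linesOf H, (rows H n).card ≤ H.card := by
  rw [Finset.card_eq_sum_card_image (fun p : ℤ × ℤ => p.1 + 1) H]
  exact Finset.sum_le_sum fun n _ => Finset.card_image_le

/-- A bound for the length added along the line `x = n` with crossing requests `R`. -/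
noncomputable def lineBound (k r m : ℕ) (R : Finset ℤ) (n : ℤ) : ℝ :=
  ∑ h ∈ Finset.range k, if (2 : ℤ) ^ (h + 1) ∣ n then
    2 ^ (h + 1) * (2 * ((heavyBlocks r R h).card : ℝ) + 6 * R.card / m) else 0

/-- The height `e` is unfolded into the conditions that `2 ^ (h + 1)` divides `n`. The portal cost,
a multiple of `2 ^ e`, is the summand `h = e - 1`, and the factor 2 for both sides turns 3 into 6.
-/
theorem lineCost_le {k r m : ℕ} (hm : 0 < m) (H : Finset (ℤ × ℤ)) (n : ℤ) :
    lineCost k r m H n ≤ lineBound k r m (rows H n) n := by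
  set R := rows H n
  set e := lineHeight k n with he
  have h1 := strand_cost r hm e R
  have hek : e ≤ k := lineHeight_le k n
  have hcost : lineCost k r m H n ≤ 2 * ((∑ h ∈ Finset.range e,
      (heavyBlocks r R h).card * 2 ^ (h + 1) : ℝ) +
        if e = 0 then 0 else 3 * (R.card : ℝ) * 2 ^ e / m) := by
    rw [lineCost]
    exact mul_le_mul_of_nonneg_left h1 two_pos.le
  refine hcost.trans ?_
  have h2 : ∑ h ∈ Finset.range e,
      (2 : ℝ) ^ (h + 1) * (2 * ((heavyBlocks r R h).card : ℝ) + 6 * R.card / m) ≤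
      lineBound k r m R n := by
    rw [lineBound, Finset.sum_congr rfl fun h hh => (if_pos ((pow_dvd_pow 2
      (Nat.succ_le_of_lt (Finset.mem_range.1 hh))).trans (pow_lineHeight_dvd k n))).symm]
    refine Finset.sum_le_sum_of_subset_of_nonneg
      (fun h hh => Finset.mem_range.2 ((Finset.mem_range.1 hh).trans_le hek)) fun h _ _ => ?_
    split_ifs
    · positivity
    · exact le_rfl
  refine le_trans ?_ h2
  simp_rw [mul_add, Finset.sum_add_distrib]
  refine add_le_add (le_of_eq ?_) ?_
  · rw [Finset.mul_sum]
    exact Finset.sum_congr rfl fun h _ => by ring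
  · split_ifs with h0
    · rw [h0]; simp
    · refine le_trans (le_of_eq ?_) (Finset.single_le_sum
        (f := fun h => (2 : ℝ) ^ (h + 1) * (6 * R.card / m)) (fun h _ => by positivity)
        (Finset.mem_range.2 (Nat.sub_one_lt h0)))
      rw [Nat.sub_add_cancel (Nat.pos_of_ne_zero h0)]
      ring

theorem card_shifts_le {k h : ℕ} (hh : h ≤ k) (l : ℤ) :
    ((Finset.range (2 ^ k)).filter fun a : ℕ => (2 : ℤ) ^ h ∣ l + a).card * 2 ^ h ≤ 2 ^ k := by
  have hp : (0 : ℤ) < 2 ^ h := by positivity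
  have h1 : ((Finset.range (2 ^ k)).filter fun a : ℕ => (2 : ℤ) ^ h ∣ l + a).card ≤
      ((Finset.Ico l (l + 2 ^ k)).filter fun x => (2 : ℤ) ^ h ∣ x).card := by
    refine Finset.card_le_card_of_injOn (fun a : ℕ => l + (a : ℤ)) (fun a ha => ?_)
      fun a _ b _ hab => by simpa using hab
    rw [Finset.mem_coe, Finset.mem_filter, Finset.mem_range] at ha
    rw [Finset.mem_coe, Finset.mem_filter, Finset.mem_Ico]
    have : (a : ℤ) < 2 ^ k := by exact_mod_cast ha.1
    exact ⟨⟨by linarith [Int.natCast_nonneg a], by linarith⟩, ha.2⟩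
  have h2 : (((Finset.Ico l (l + 2 ^ k)).filter fun x => (2 : ℤ) ^ h ∣ x).card : ℤ) =
      2 ^ (k - h) := by
    have h3 : ((l + 2 ^ k : ℤ) : ℚ) / ((2 ^ h : ℤ) : ℚ) =
        (l : ℚ) / ((2 ^ h : ℤ) : ℚ) + ((2 ^ (k - h) : ℤ) : ℚ) := by
      obtain ⟨d, rfl⟩ := Nat.exists_eq_add_of_le hh
      rw [Nat.add_sub_cancel_left]
      push_cast
      rw [pow_add]
      field_simp
    rw [Int.Ico_filter_dvd_card _ _ hp, h3, Int.ceil_add_intCast, add_sub_cancel_left]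
    exact max_eq_left (by positivity)
  have h4 : ((Finset.Ico l (l + 2 ^ k)).filter fun x => (2 : ℤ) ^ h ∣ x).card = 2 ^ (k - h) := by
    exact_mod_cast h2
  calc _ ≤ 2 ^ (k - h) * 2 ^ h := Nat.mul_le_mul_right _ (h1.trans_eq h4)
    _ = 2 ^ k := by rw [← pow_add, Nat.sub_add_cancel hh]

/-- The weight `2 ^ (h + 1)` cancels against the fraction of shifts for which the divisibility
holds. Heavy blocks then sum to at most `R.card / r`, while the portal term occurs once per height,
which gives the factor `k`. -/
theorem sum_lineBound_le {k r m : ℕ} (hr : 0 < r) (R : Finset ℤ) (l : ℤ) :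
    ∑ a ∈ Finset.range (2 ^ k), lineBound k r m R (l + (a : ℕ)) ≤
      2 ^ k * (R.card * (2 / r + 6 * k / m)) := by
  have hr' : (0 : ℝ) < r := by exact_mod_cast hr
  unfold lineBound
  rw [Finset.sum_comm]
  have h1 : ∀ h ∈ Finset.range k, (∑ a ∈ Finset.range (2 ^ k),
      if (2 : ℤ) ^ (h + 1) ∣ l + (a : ℕ) then
        2 ^ (h + 1) * (2 * ((heavyBlocks r R h).card : ℝ) + 6 * R.card / m) else 0) ≤
      2 ^ k * (2 * ((heavyBlocks r R h).card : ℝ) + 6 * R.card / m) := by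
    intro h hh
    rw [← Finset.sum_filter, Finset.sum_const, nsmul_eq_mul, ← mul_assoc]
    refine mul_le_mul_of_nonneg_right ?_ (by positivity)
    exact_mod_cast card_shifts_le (Finset.mem_range.1 hh) l
  refine (Finset.sum_le_sum h1).trans ?_
  rw [← Finset.mul_sum, Finset.sum_add_distrib, ← Finset.mul_sum, Finset.sum_const,
    Finset.card_range, nsmul_eq_mul]
  refine mul_le_mul_of_nonneg_left ?_ (by positivity)
  have h2 : (r : ℝ) * ∑ h ∈ Finset.range k, ((heavyBlocks r R h).card : ℝ) ≤ R.card := by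
    exact_mod_cast (Nat.le_add_right _ _).trans (sum_heavyBlocks_le r R k)
  have h3 : ∑ h ∈ Finset.range k, ((heavyBlocks r R h).card : ℝ) ≤ R.card / r := by
    rw [le_div_iff₀ hr']; linarith
  calc _ ≤ 2 * ((R.card : ℝ) / r) + k * (6 * R.card / m) := by gcongr
    _ = _ := by ring

theorem lineCost_nonneg (k r m : ℕ) (H : Finset (ℤ × ℤ)) (n : ℤ) : 0 ≤ lineCost k r m H n :=
  mul_nonneg two_pos.le (add_nonneg (Nat.cast_nonneg _)
    (Finset.sum_nonneg fun _ _ => Int.fract_nonneg _))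

/-- The length added along all vertical lines. -/
noncomputable def totalCost (k r m : ℕ) (H : Finset (ℤ × ℤ)) : ℝ :=
  ∑ n ∈ linesOf H, lineCost k r m H n

theorem totalCost_nonneg (k r m : ℕ) (H : Finset (ℤ × ℤ)) : 0 ≤ totalCost k r m H :=
  Finset.sum_nonneg fun n _ => lineCost_nonneg k r m H n

theorem sum_totalCost_le {k r m : ℕ} (hr : 0 < r) (hm : 0 < m) (H : Finset (ℤ × ℤ)) (b : ℕ) :
    ∑ a ∈ Finset.range (2 ^ k), totalCost k r m (translate H a b) ≤
      2 ^ k * (H.card * (2 / r + 6 * k / m)) := by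
  have h1 : ∀ a ∈ Finset.range (2 ^ k), totalCost k r m (translate H a b) ≤
      ∑ l ∈ linesOf H, lineBound k r m ((rows H l).image fun y => y + (b : ℤ)) (l + (a : ℕ)) := by
    intro a _
    rw [totalCost, linesOf_translate, Finset.sum_image (fun _ _ _ _ h => add_right_cancel h)]
    refine Finset.sum_le_sum fun l _ => ?_
    rw [← rows_translate H a b l]
    exact lineCost_le hm _ _
  refine (Finset.sum_le_sum h1).trans ?_
  rw [Finset.sum_comm]
  refine (Finset.sum_le_sum fun l _ => sum_lineBound_le hr _ l).trans ?_
  rw [← Finset.mul_sum, ← Finset.sum_mul]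
  refine mul_le_mul_of_nonneg_left (mul_le_mul_of_nonneg_right ?_ (by positivity)) (by positivity)
  simp_rw [Finset.card_image_of_injective _ (add_left_injective (b : ℤ))]
  exact_mod_cast sum_card_rows_le H

/-- Markov's inequality: at least half of the values are at most twice the mean. -/
theorem half_card_le_of_sum_le {ι : Type*} (s : Finset ι) (f : ι → ℝ) (hf : ∀ i ∈ s, 0 ≤ f i)
    {c : ℝ} (hc : 0 ≤ c) (h : ∑ i ∈ s, f i ≤ s.card * c) :
    (s.card : ℝ) / 2 ≤ (s.filter fun i => f i ≤ 2 * c).card := by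
  classical
  have hsplit := Finset.card_filter_add_card_filter_not (s := s) (fun i => f i ≤ 2 * c)
  have hsplit' : ((s.filter fun i => f i ≤ 2 * c).card : ℝ) +
      (s.filter fun i => ¬ f i ≤ 2 * c).card = s.card := by exact_mod_cast hsplit
  set B := s.filter fun i => ¬ f i ≤ 2 * c with hB
  have hBle : (B.card : ℝ) ≤ s.card / 2 := by
    -- For `c = 0` all values vanish. Otherwise `c` can be cancelled.
    rcases hc.eq_or_lt with rfl | hc
    · have h0 := (Finset.sum_eq_zero_iff_of_nonneg hf).1
        (le_antisymm (by simpa using h) (Finset.sum_nonneg hf))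
      have : B = ∅ := Finset.filter_eq_empty_iff.2 fun i hi => by simp [h0 i hi]
      rw [this, Finset.card_empty, Nat.cast_zero]
      positivity
    · have h1 : (B.card : ℝ) * (2 * c) ≤ ∑ i ∈ B, f i := by
        rw [← nsmul_eq_mul]
        exact Finset.card_nsmul_le_sum _ _ _ fun i hi =>
          (not_le.1 (Finset.mem_filter.1 hi).2).le
      have h2 : ∑ i ∈ B, f i ≤ ∑ i ∈ s, f i :=
        Finset.sum_le_sum_of_subset_of_nonneg (Finset.filter_subset _ _) fun i hi _ => hf i hi
      have h3 : (B.card : ℝ) * 2 * c ≤ s.card * c := by linarith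
      linarith [le_of_mul_le_mul_right h3 hc]
  linarith

theorem translate_swap (K : Finset (ℤ × ℤ)) (a b : ℕ) :
    (translate K a b).image Prod.swap = translate (K.image Prod.swap) b a := by
  simp only [translate, Finset.image_image]
  rfl

end RSMT

/-! ### The structure theorem -/

theorem theorem1 :
    ∃ C : ℝ, 0 < C ∧ ∀ (k L : ℕ), L = 2 ^ k →
      ∀ V : Finset (ℤ × ℤ),
        (∀ p ∈ V, 0 ≤ p.1 ∧ p.1 ≤ L ∧ 0 ≤ p.2 ∧ p.2 ≤ L) →
      ∀ m r : ℕ, 0 < m → 0 < r →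
        1 / 2 ≤ RSMT.shiftProb L (fun a b =>
          ∃ T : RSMT.SteinerTree (RSMT.shifted V a b),
            T.IsLight (2 * (L : ℝ)) m r ∧
            T.length ≤ (1 + 4 / (r : ℝ) + C * (4 * Real.log L / (m : ℝ))) *
              RSMT.opt (RSMT.shifted V 0 0)) := by
  -- Doubling the mean excess leaves `12 * k / m`, and `12 ≤ 5 * 4 * log 2` since `log 2 > 0.69`.
  refine ⟨5, by norm_num, ?_⟩
  rintro k L rfl V hV m r hm hr
  obtain ⟨H, K, hconn, hH, hK, hopt⟩ := RSMT.exists_unit_edges (2 ^ k) V hV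
  set K' := K.image Prod.swap with hK'
  have hcardK' : K'.card = K.card := Finset.card_image_of_injective _ Prod.swap_injective
  set c : ℝ := ((H.card + K.card : ℕ) : ℝ) * (2 / r + 6 * k / m) with hc
  have hc0 : 0 ≤ c := by positivity
  let f : ℕ × ℕ → ℝ := fun s => RSMT.totalCost k r m (RSMT.translate H s.1 s.2) +
    RSMT.totalCost k r m (RSMT.translate K' s.2 s.1)
  have hf : ∀ s, 0 ≤ f s := fun s =>
    add_nonneg (RSMT.totalCost_nonneg _ _ _ _) (RSMT.totalCost_nonneg _ _ _ _)
  set S := Finset.range (2 ^ k) ×ˢ Finset.range (2 ^ k) with hS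
  have hScard : (S.card : ℝ) = ((2 ^ k : ℕ) : ℝ) ^ 2 := by
    rw [hS, Finset.card_product, Finset.card_range]
    push_cast
    ring
  have hsum : ∑ s ∈ S, f s ≤ S.card * c := by
    have h1 : ∑ s ∈ S, RSMT.totalCost k r m (RSMT.translate H s.1 s.2) ≤
        2 ^ k * (2 ^ k * (H.card * (2 / r + 6 * k / m))) := by
      -- For horizontal edges `b` is fixed and `a` averaged. For the reflected vertical edges the
      -- roles are exchanged.
      rw [hS, Finset.sum_product_right]
      refine (Finset.sum_le_card_nsmul _ _ _ fun b _ =>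
        RSMT.sum_totalCost_le hr hm H b).trans_eq ?_
      rw [Finset.card_range, nsmul_eq_mul]
      push_cast
      rfl
    have h2 : ∑ s ∈ S, RSMT.totalCost k r m (RSMT.translate K' s.2 s.1) ≤
        2 ^ k * (2 ^ k * (K.card * (2 / r + 6 * k / m))) := by
      rw [hS, Finset.sum_product, ← hcardK']
      refine (Finset.sum_le_card_nsmul _ _ _ fun b _ =>
        RSMT.sum_totalCost_le hr hm K' b).trans_eq ?_
      rw [Finset.card_range, nsmul_eq_mul]
      push_cast
      rfl
    rw [Finset.sum_add_distrib, hScard, hc]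
    push_cast
    calc _ ≤ _ := add_le_add h1 h2
      _ = _ := by ring
  have hmarkov := RSMT.half_card_le_of_sum_le S f (fun s _ => hf s) hc0 hsum
  have hgood : ∀ s ∈ S, f s ≤ 2 * c → ∃ T : RSMT.SteinerTree (RSMT.shifted V s.1 s.2),
      T.IsLight (2 * ((2 ^ k : ℕ) : ℝ)) m r ∧
      T.length ≤ (1 + 4 / (r : ℝ) + 5 * (4 * Real.log (2 ^ k : ℕ) / (m : ℝ))) *
        RSMT.opt (RSMT.shifted V 0 0) := by
    rintro ⟨a, b⟩ hab hfab
    rw [hS, Finset.mem_product, Finset.mem_range, Finset.mem_range] at hab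
    obtain ⟨ha, hb⟩ := hab
    dsimp only at ha hb ⊢
    have hpow : (2 : ℤ) ^ (k + 1) = 2 * ((2 ^ k : ℕ) : ℤ) := by push_cast; ring
    have hD : (2 : ℝ) * ((2 ^ k : ℕ) : ℝ) = 2 ^ (k + 1) := by push_cast; ring
    obtain ⟨T, hT, hlen⟩ := RSMT.exists_light_tree_of_connects (k := k) (m := m) (r := r) hr
      (H := RSMT.translate H a b) (K := RSMT.translate K a b) (V₀ := RSMT.translate V a b)
      (fun p hp => by
        obtain ⟨q, hq, rfl⟩ := Finset.mem_image.1 hp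
        have := hH q hq
        rw [hpow]
        dsimp only
        omega)
      (fun p hp => by
        obtain ⟨q, hq, rfl⟩ := Finset.mem_image.1 hp
        have := hK q hq
        rw [hpow]
        dsimp only
        omega)
      (hconn.translate a b) (V := RSMT.shifted V a b) (fun p hp => by
        obtain ⟨q, hq, rfl⟩ := Finset.mem_map.1 hp
        exact ⟨_, Finset.mem_image_of_mem _ hq, by
          push_cast
          rfl⟩)
    refine ⟨T, by rw [hD]; exact hT, hlen.trans ?_⟩
    rw [RSMT.card_translate, RSMT.card_translate, RSMT.translate_swap]
    have hlog : (k : ℝ) * 12 ≤ 5 * (4 * Real.log (2 ^ k : ℕ)) := by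
      rw [Nat.cast_pow, Real.log_pow]
      have := Real.log_two_gt_d9
      push_cast
      have hk : (0 : ℝ) ≤ k := Nat.cast_nonneg k
      nlinarith
    have hm' : (0 : ℝ) < m := by exact_mod_cast hm
    have hcoef : 0 ≤ 1 + 4 / (r : ℝ) + 12 * k / m := by positivity
    calc _ ≤ ((H.card + K.card : ℕ) : ℝ) + 2 * c := by
          gcongr
          exact hfab
      _ = (1 + 4 / (r : ℝ) + 12 * k / m) * ((H.card + K.card : ℕ) : ℝ) := by rw [hc]; ring
      _ ≤ (1 + 4 / (r : ℝ) + 12 * k / m) * RSMT.opt (RSMT.shifted V 0 0) :=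
          mul_le_mul_of_nonneg_left hopt hcoef
      _ ≤ _ := by
          refine mul_le_mul_of_nonneg_right ?_ (le_trans (Nat.cast_nonneg _) hopt)
          rw [← mul_div_assoc]
          exact add_le_add_right (div_le_div_of_nonneg_right (by linarith) hm'.le) _
  classical
  unfold RSMT.shiftProb
  rw [le_div_iff₀ (by positivity), ← hScard]
  refine le_trans (by linarith) (hmarkov.trans ?_)
  refine Nat.cast_le.2 (Finset.card_le_card fun s hs => ?_)
  rw [Finset.mem_filter] at hs ⊢
  exact ⟨hs.1, hgood s hs.1 hs.2⟩
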